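/- Let $d\ge 5$, let $(S_k)_{k\ge 0}$ be the simple symmetric nearest-neighbour random walk on $\mathbb Z^d$ started at $S_0=0$, and let $\mathbb P_0$ (with expectation $\mathbb E_0$) denote its law. For $n\ge 0$ and $x\in\mathbb Z^d$ let $$l_n(x)=\sum_{k=0}^{n}\mathbf 1\{S_k=x\},\qquad l_\infty(x)=\sum_{k=0}^{\infty}\mathbf 1\{S_k=x\},\qquad G_d(x)=\mathbb E_0[l_\infty(x)].$$ Fix $b>0$ and real numbers $\gamma,z$, and let $\underline{\mathcal D}_b=\{x\in\mathbb Z^d:\ l_n(x)\le n^b\}$. Assume that either (i) $\gamma=1$ and $z>1+2\sum_{x\in\mathbb Z^d}G_d(x)^2$, or (ii) $\gamma>1$ and $z>0$. Then for every real $\zeta<\gamma-b-\frac2d(\gamma-2b)$ there is a constant $c>0$ (which may depend on $d,b,\gamma,z,\zeta$) such that for all sufficiently large $n$ $$\mathbb P_0\Big(\sum_{x\in\underline{\mathcal D}_b}l_n(x)^2\ \ge\ n^\gamma z\Big)\ \le\ \exp(-c\,n^\zeta).$$ -/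

import Mathlib

open MeasureTheory ProbabilityTheory
open scoped ENNReal

namespace SimpleRandomWalk

/-- The `2 * d` possible nearest neighbor steps on `ℤ^d`: the pair `(i, true)` stands for the step
`+ e_i`, the pair `(i, false)` for the step `- e_i`. -/
abbrev Step (d : ℕ) : Type := Fin d × Bool

/-- The displacement in `ℤ^d` made by a step. -/
def Step.toVec {d : ℕ} (s : Step d) : Fin d → ℤ :=
  Pi.single s.1 (if s.2 then 1 else -1)

/-- The law `P_0` of the walk, carried by the sequences of steps: the steps are independent,
and each of them is uniformly distributed on the `2 * d` possibilities. -/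
noncomputable def P₀ (d : ℕ) [NeZero d] : Measure (ℕ → Step d) :=
  Measure.infinitePi fun _ : ℕ => uniformOn (Set.univ : Set (Step d))

/-- The position `S_k` at time `k` of the walk started at the origin. -/
def S {d : ℕ} (k : ℕ) (ω : ℕ → Step d) : Fin d → ℤ :=
  ∑ j ∈ Finset.range k, (ω j).toVec

/-- The local time `l_n(x)`: the number of times `k ∈ {0, …, n}` with `S_k = x`. -/
def localTime {d : ℕ} (n : ℕ) (ω : ℕ → Step d) (x : Fin d → ℤ) : ℕ :=
  ((Finset.range (n + 1)).filter fun k => S k ω = x).card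

/-- The total local time `l_∞(x)`: the number (possibly infinite) of times `k ≥ 0` with
`S_k = x`. -/
noncomputable def totalLocalTime {d : ℕ} (ω : ℕ → Step d) (x : Fin d → ℤ) : ℝ≥0∞ :=
  ∑' k : ℕ, if S k ω = x then 1 else 0

/-- The Green kernel `G_d(x) = E_0[l_∞(x)]`, with values in `[0, ∞]`. -/
noncomputable def green (d : ℕ) [NeZero d] (x : Fin d → ℤ) : ℝ≥0∞ :=
  ∫⁻ ω, totalLocalTime ω x ∂(P₀ d)

/-- The set `{x ∈ ℤ^d : l_n(x) ≤ n^b}` of the sites that are visited at most `n^b` times. -/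
def lowSites {d : ℕ} (b : ℝ) (n : ℕ) (ω : ℕ → Step d) : Set (Fin d → ℤ) :=
  {x | (localTime n ω x : ℝ) ≤ (n : ℝ) ^ b}

/-- Only finitely many sites are visited up to time `n`. -/
theorem finite_support_localTime {d : ℕ} (n : ℕ) (ω : ℕ → Step d) :
    (Function.support fun x => localTime n ω x).Finite := by
  refine (((Finset.range (n + 1)).image fun k => S k ω).finite_toSet).subset fun x hx => ?_
  obtain ⟨k, hk⟩ := Finset.card_ne_zero.mp hx
  rw [Finset.mem_filter] at hk
  exact Finset.mem_coe.mpr (Finset.mem_image.mpr ⟨k, hk.1, hk.2⟩)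

/-- The self-intersection sum `∑ l_n(x)^2` over the sites `x` with `l_n(x) ≤ n^b`. Only finitely
many terms differ from zero. -/
noncomputable def lowSum {d : ℕ} (b : ℝ) (n : ℕ) (ω : ℕ → Step d) : ℝ :=
  ∑' x : lowSites b n ω, (localTime n ω (x : Fin d → ℤ) : ℝ) ^ 2

/-- The sum that defines `lowSum` converges. -/
theorem summable_lowSum {d : ℕ} (b : ℝ) (n : ℕ) (ω : ℕ → Step d) :
    Summable fun x : lowSites b n ω => (localTime n ω (x : Fin d → ℤ) : ℝ) ^ 2 := by
  have h : Summable fun x : Fin d → ℤ => (localTime n ω x : ℝ) ^ 2 := by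
    refine summable_of_hasFiniteSupport ((finite_support_localTime n ω).subset fun x hx => ?_)
    intro h0
    exact hx (by simp [h0])
  exact h.subtype _

end SimpleRandomWalk

namespace SimpleRandomWalk

/-! Let `V j` be the number of sites visited at least `j` times up to time `n`. Every visit has a
rank (first, second, … visit to its site), and `l ^ 2` is the sum of `2 r - 1` over the ranks `r ≤
l`. Hence `lowSum ≤ 2 X - Y`, where `X = ∑ j * V j` and `Y = ∑ V j` over `1 ≤ j ≤ J`, with `J` about
`n ^ b`, and `Y ≤ n + 1`. The visits of rank at least `j` number at least `V j + … + V J`, and they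
are exactly the times spent in the growing set of sites visited `j` times.

A site joining that set adds an expected time `G(0)` to be spent there. So the time in the set
should not exceed `D * V j`, with the safety factor `D = 3/2 * G(0)`, beyond a fluctuation. An
exponential supermartingale (`average_levelFunctional_le`) makes this precise. The scale of the
fluctuation is the largest potential of a set of that size, at most `C * |A| ^ ρ` for each `ρ > 2/d`
(`exists_sum_greenReal_le`, from the heat kernel bound `heatKernel_sq_le`). So
(`measure_revisits_le`, `measure_bad_le`), up to a probability of order `exp (-c E)` times a
polynomial in `n`, `V j + … + V J ≤ D * V j + E * V j ^ ρ` for all `j`.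

Summing over `j` and using `V j ≤ 2 X / j ^ 2` gives `X ≤ D Y + const * E * (2 X) ^ ρ * J ^ (1 -
2ρ)` (`weighted_sum_le`); here `ρ < 1/2`, possible since `d ≥ 5`. Take `E = n ^ σ` with `σ < γ - b -
ρ (γ - 2b)`: if `2 X ≥ n ^ γ z`, the last term is `o(X)`, which forces `n ^ γ z ≤ (2 D - 1 + o(1))
n`. This fails for large `n`: clearly if `γ > 1`, and if `γ = 1` because `2 D - 1 = 3 G(0) - 1 < 1 +
2 G(0) ^ 2`. Letting `ρ` decrease to `2/d` reaches every admissible `ζ`. -/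

/-! ### One-dimensional walk: the bound of order `m ^ (-1/2)`, in squared form -/

/-- The transition probabilities from the origin of the simple random walk on `ℤ`. -/
noncomputable def lineKernel : ℕ → ℤ → ℝ
  | 0, v => if v = 0 then 1 else 0
  | m + 1, v => (lineKernel m (v - 1) + lineKernel m (v + 1)) / 2

theorem lineKernel_eq (m : ℕ) :
    (∀ j : ℕ, lineKernel m (2 * j - m) = m.choose j / 2 ^ m) ∧
      ∀ v : ℤ, (∀ j : ℕ, v ≠ 2 * j - m) → lineKernel m v = 0 := by
  induction m with
  | zero =>
    refine ⟨fun j => ?_, fun v hv => ?_⟩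
    · rcases j with _ | j
      · simp [lineKernel]
      · rw [lineKernel, if_neg (by push_cast; omega)]
        simp
    · rw [lineKernel, if_neg]
      simpa using hv 0
  | succ m ih =>
    obtain ⟨ih1, ih2⟩ := ih
    refine ⟨fun j => ?_, fun v hv => ?_⟩
    · have e2 : (2 * (j : ℤ) - ((m + 1 : ℕ) : ℤ) + 1) = 2 * j - m := by push_cast; ring
      rw [lineKernel, e2, ih1 j]
      rcases j with _ | j
      · rw [ih2 _ (fun j => by push_cast; omega)]
        simp only [Nat.choose_zero_right]
        field_simp
        ring
      · have e1 : (2 * ((j + 1 : ℕ) : ℤ) - ((m + 1 : ℕ) : ℤ) - 1) = 2 * j - m := by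
          push_cast; ring
        rw [e1, ih1 j, Nat.choose_succ_succ]
        push_cast
        field_simp
        ring
    · rw [lineKernel, ih2 (v - 1), ih2 (v + 1)]
      · simp
      · intro j h
        exact hv j (by push_cast; omega)
      · intro j h
        exact hv (j + 1) (by push_cast; omega)

/-- The induction step reduces to `(2r + 1)(2r + 3) ≤ 4 (r + 1) ^ 2`. -/
theorem centralBinom_sq_mul_le (r : ℕ) : r.centralBinom ^ 2 * (2 * r + 1) ≤ 16 ^ r := by
  induction r with
  | zero => simp
  | succ r ih =>
    have h := Nat.succ_mul_centralBinom_succ r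
    have h2 : (r + 1) ^ 2 * ((r + 1).centralBinom ^ 2 * (2 * (r + 1) + 1)) ≤
        (r + 1) ^ 2 * 16 ^ (r + 1) := by
      calc (r + 1) ^ 2 * ((r + 1).centralBinom ^ 2 * (2 * (r + 1) + 1))
          = ((r + 1) * (r + 1).centralBinom) ^ 2 * (2 * r + 3) := by ring
        _ = (2 * (2 * r + 1) * r.centralBinom) ^ 2 * (2 * r + 3) := by rw [h]
        _ = (r.centralBinom ^ 2 * (2 * r + 1)) * (4 * ((2 * r + 1) * (2 * r + 3))) := by ring
        _ ≤ 16 ^ r * (4 * ((2 * r + 1) * (2 * r + 3))) := by gcongr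
        _ ≤ 16 ^ r * (16 * (r + 1) ^ 2) := by
          apply Nat.mul_le_mul_left
          nlinarith
        _ = (r + 1) ^ 2 * 16 ^ (r + 1) := by ring
    exact Nat.le_of_mul_le_mul_left h2 (by positivity)

theorem choose_half_sq_mul_le (m : ℕ) : m.choose (m / 2) ^ 2 * (m + 1) ≤ 4 ^ m := by
  rcases Nat.even_or_odd' m with ⟨r, rfl | rfl⟩
  · have h := centralBinom_sq_mul_le r
    rw [Nat.centralBinom] at h
    rw [Nat.mul_div_cancel_left _ (by norm_num), pow_mul]
    exact h
  · have h := centralBinom_sq_mul_le (r + 1)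
    have e : (2 * r + 1) / 2 = r := by omega
    have e2 : (r + 1).centralBinom = 2 * (2 * r + 1).choose r := by
      have h1 : 2 * (r + 1) = 2 * r + 1 + 1 := by ring
      rw [Nat.centralBinom, h1, Nat.choose_succ_succ, Nat.choose_symm_half]
      ring
    rw [e2] at h
    rw [e]
    have h16 : (16 : ℕ) ^ (r + 1) = 4 * 4 ^ (2 * r + 1) := by
      rw [pow_succ, pow_succ, pow_mul]; norm_num; ring
    rw [h16] at h
    nlinarith [sq_nonneg ((2 * r + 1).choose r)]

theorem lineKernel_sq_le (m : ℕ) (v : ℤ) : lineKernel m v ^ 2 ≤ 1 / ((m : ℝ) + 1) := by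
  by_cases hv : ∃ j : ℕ, v = 2 * j - m
  · obtain ⟨j, rfl⟩ := hv
    rw [(lineKernel_eq m).1 j, div_pow, div_le_div_iff₀ (by positivity) (by positivity), one_mul,
      ← pow_mul, mul_comm m 2, pow_mul]
    have h1 : (m.choose j) ^ 2 * (m + 1) ≤ 4 ^ m :=
      (Nat.mul_le_mul_right _ (Nat.pow_le_pow_left (Nat.choose_le_middle j m) 2)).trans
        (choose_half_sq_mul_le m)
    norm_num
    exact_mod_cast h1
  · push Not at hv
    rw [(lineKernel_eq m).2 v hv]
    simp only [ne_eq, OfNat.ofNat_ne_zero, not_false_eq_true, zero_pow]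
    positivity

/-! ### Multinomial averages and their inverse moments -/

section MultiAvg

variable {ι : Type*} [Fintype ι] [DecidableEq ι]

/-- The expectation of `g (N)`, where `N` counts how often each element of `ι` shows up among `k`
independent uniform draws. -/
noncomputable def multiAvg : ℕ → ((ι → ℕ) → ℝ) → ℝ
  | 0, g => g 0
  | k + 1, g => (∑ i, multiAvg k fun c => g (c + Pi.single i 1)) / Fintype.card ι

theorem multiAvg_mono (k : ℕ) {g h : (ι → ℕ) → ℝ} (H : ∀ c, g c ≤ h c) :
    multiAvg k g ≤ multiAvg k h := by
  induction k generalizing g h with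
  | zero => exact H 0
  | succ k ih =>
    rw [multiAvg, multiAvg]
    gcongr with i
    exact ih fun c => H _

theorem multiAvg_add (k : ℕ) (g h : (ι → ℕ) → ℝ) :
    multiAvg k (fun c => g c + h c) = multiAvg k g + multiAvg k h := by
  induction k generalizing g h with
  | zero => rfl
  | succ k ih =>
    simp only [multiAvg]
    rw [← add_div, ← Finset.sum_add_distrib]
    simp only [ih]

theorem multiAvg_const_mul (k : ℕ) (a : ℝ) (g : (ι → ℕ) → ℝ) :
    multiAvg k (fun c => a * g c) = a * multiAvg k g := by
  induction k generalizing g with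
  | zero => rfl
  | succ k ih =>
    simp only [multiAvg]
    rw [mul_div_assoc', Finset.mul_sum]
    simp only [ih]

theorem multiAvg_one [Nonempty ι] (k : ℕ) : multiAvg k (fun _ : ι → ℕ => (1 : ℝ)) = 1 := by
  induction k with
  | zero => rfl
  | succ k ih => simp [multiAvg, ih]

theorem sq_multiAvg_le [Nonempty ι] (k : ℕ) (g : (ι → ℕ) → ℝ) :
    multiAvg k g ^ 2 ≤ multiAvg k fun c => g c ^ 2 := by
  induction k generalizing g with
  | zero => exact le_rfl
  | succ k ih =>
    simp only [multiAvg]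
    have hc : (0 : ℝ) < Fintype.card ι := by exact_mod_cast Fintype.card_pos
    rw [div_pow, div_le_div_iff₀ (by positivity) hc]
    have h1 := sq_sum_le_card_mul_sum_sq (s := Finset.univ)
      (f := fun i => multiAvg k fun c => g (c + Pi.single i 1))
    have h2 : ∑ i, (multiAvg k fun c => g (c + Pi.single i 1)) ^ 2 ≤
        ∑ i, multiAvg k fun c => g (c + Pi.single i 1) ^ 2 := by
      gcongr with i
      exact ih _
    rw [Finset.card_univ] at h1
    calc _ ≤ ((Fintype.card ι : ℝ) * ∑ i, (multiAvg k fun c => g (c + Pi.single i 1)) ^ 2) *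
          Fintype.card ι := by gcongr
      _ ≤ ((Fintype.card ι : ℝ) * ∑ i, multiAvg k fun c => g (c + Pi.single i 1) ^ 2) *
          Fintype.card ι := by gcongr
      _ = _ := by ring

/-- Size-biasing: by exchangeability, each of the `k + 1` draws contributes equally to `c i`, and
given that a draw equals `i` the other `k` are still uniform. The induction splits off one draw. -/
theorem multiAvg_succ_coord_mul [Nonempty ι] (k : ℕ) (i : ι) (g : (ι → ℕ) → ℝ) :
    multiAvg (k + 1) (fun c => c i * g c) =
      (k + 1) / Fintype.card ι * multiAvg k fun c => g (c + Pi.single i 1) := by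
  have hc : (Fintype.card ι : ℝ) ≠ 0 := by exact_mod_cast Fintype.card_ne_zero
  have key : ∀ (k : ℕ) (g : (ι → ℕ) → ℝ), multiAvg (k + 1) (fun c => c i * g c) =
      (∑ j, multiAvg k fun c => c i * g (c + Pi.single j 1)) / Fintype.card ι +
        (multiAvg k fun c => g (c + Pi.single i 1)) / Fintype.card ι := by
    intro k g
    rw [multiAvg, ← add_div]
    congr 1
    have : ∀ j, (multiAvg k fun c => ((c + Pi.single j 1 : ι → ℕ) i : ℝ) *
        g (c + Pi.single j 1)) = (multiAvg k fun c => c i * g (c + Pi.single j 1)) +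
          if j = i then (multiAvg k fun c => g (c + Pi.single i 1)) else 0 := by
      intro j
      split_ifs with h
      · subst h
        rw [← multiAvg_add]
        congr 1
        ext c
        simp
        ring
      · rw [add_zero]
        refine congrArg (multiAvg k) (funext fun c => ?_)
        simp [Pi.single_eq_of_ne (Ne.symm h)]
    simp only [this, Finset.sum_add_distrib, Finset.sum_ite_eq', Finset.mem_univ, if_true]
  induction k generalizing g with
  | zero =>
    rw [key]
    simp [multiAvg]
    ring
  | succ k ih =>
    rw [key]
    simp only [ih]
    have : (multiAvg (k + 1) fun c => g (c + Pi.single i 1)) =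
        (∑ j, multiAvg k fun c => g (c + Pi.single j 1 + Pi.single i 1)) / Fintype.card ι := rfl
    rw [this, ← Finset.mul_sum]
    have e : ∀ j, (multiAvg k fun c => g (c + Pi.single i 1 + Pi.single j 1)) =
        multiAvg k fun c => g (c + Pi.single j 1 + Pi.single i 1) := by
      intro j
      congr 1
      ext c
      rw [add_right_comm]
    simp only [e]
    field_simp
    push_cast
    ring

theorem multiAvg_prod_inv_le [Nonempty ι] (k : ℕ) (I : Finset ι) :
    (multiAvg k fun c => ∏ i ∈ I, 1 / ((c i : ℝ) + 1)) ≤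
      ((Fintype.card ι : ℝ) / (k + 1)) ^ I.card := by
  have hc : (0 : ℝ) < Fintype.card ι := by exact_mod_cast Fintype.card_pos
  induction I using Finset.induction_on generalizing k with
  | empty => simp [multiAvg_one]
  | insert i I hi ih =>
    -- The division by `c i` turns into the missing factor `1 / (c i + 1)` after the shift by one.
    -- Where `c i = 0` the product `c i * (… / c i)` is `0`, which only helps the upper bound.
    have hp := multiAvg_succ_coord_mul k i fun c => (∏ j ∈ I, 1 / ((c j : ℝ) + 1)) / c i
    have e1 : ∀ c : ι → ℕ, (∏ j ∈ I, 1 / (((c + Pi.single i 1 : ι → ℕ) j : ℝ) + 1)) /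
        ((c + Pi.single i 1 : ι → ℕ) i : ℝ) = ∏ j ∈ insert i I, 1 / ((c j : ℝ) + 1) := by
      intro c
      rw [Finset.prod_insert hi, div_eq_mul_inv, mul_comm]
      congr 1
      · simp
      · refine Finset.prod_congr rfl fun j hj => ?_
        have : j ≠ i := fun h => hi (h ▸ hj)
        simp [Pi.single_eq_of_ne this]
    simp only [e1] at hp
    have h2 : (multiAvg (k + 1) fun c => (c i : ℝ) * ((∏ j ∈ I, 1 / ((c j : ℝ) + 1)) / c i)) ≤
        multiAvg (k + 1) fun c => ∏ j ∈ I, 1 / ((c j : ℝ) + 1) := by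
      refine multiAvg_mono _ fun c => ?_
      have hP : 0 ≤ ∏ j ∈ I, 1 / ((c j : ℝ) + 1) := Finset.prod_nonneg fun j _ => by positivity
      rcases Nat.eq_zero_or_pos (c i) with h | h
      · simpa [h] using hP
      · rw [mul_div_cancel₀]
        exact_mod_cast h.ne'
    have h3 := h2.trans (ih (k + 1))
    rw [hp] at h3
    have h4 : ((Fintype.card ι : ℝ) / ((k + 1 : ℕ) + 1)) ^ I.card ≤
        ((Fintype.card ι : ℝ) / (k + 1)) ^ I.card := by
      push_cast
      gcongr
      linarith
    rw [Finset.card_insert_of_notMem hi, pow_succ]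
    have h5 := h3.trans h4
    rw [div_mul_eq_mul_div, div_le_iff₀ hc] at h5
    rw [mul_div_assoc', le_div_iff₀ (by positivity)]
    linarith

end MultiAvg

/-! ### Heat kernel bound of order `k ^ (-d/2)` -/

/-- The transition probabilities from the origin of the simple random walk on `ℤ^d`. -/
noncomputable def heatKernel (d : ℕ) : ℕ → (Fin d → ℤ) → ℝ
  | 0, v => if v = 0 then 1 else 0
  | k + 1, v => (∑ s : Step d, heatKernel d k (v - s.toVec)) / (2 * d)

theorem heatKernel_nonneg (d k : ℕ) (v : Fin d → ℤ) : 0 ≤ heatKernel d k v := by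
  induction k generalizing v with
  | zero => rw [heatKernel]; split_ifs <;> norm_num
  | succ k ih =>
    rw [heatKernel]
    have := Finset.sum_nonneg fun (s : Step d) (_ : s ∈ Finset.univ) => ih (v - s.toVec)
    positivity

/-- Given how many steps are made along each axis, the coordinates are independent one-dimensional
walks. -/
theorem heatKernel_eq_multiAvg (d k : ℕ) (v : Fin d → ℤ) :
    heatKernel d k v = multiAvg k fun c => ∏ i, lineKernel (c i) (v i) := by
  induction k generalizing v with
  | zero =>
    simp only [heatKernel, multiAvg, lineKernel]
    rw [Finset.prod_ite_zero]
    simp [funext_iff]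
  | succ k ih =>
    rw [heatKernel, multiAvg, Fintype.sum_prod_type, Fintype.card_fin, mul_comm, ← div_div,
      div_right_comm, Finset.sum_div]
    congr 1
    refine Finset.sum_congr rfl fun i _ => ?_
    simp only [ih, Fintype.sum_bool]
    rw [← multiAvg_add, div_eq_inv_mul, ← multiAvg_const_mul]
    congr 1
    ext c
    have hoff : ∀ b : Bool, ∏ j ∈ Finset.univ.erase i,
        lineKernel (c j) ((v - Step.toVec (i, b)) j) =
          ∏ j ∈ Finset.univ.erase i, lineKernel ((c + Pi.single i 1 : Fin d → ℕ) j) (v j) := by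
      intro b
      refine Finset.prod_congr rfl fun j hj => ?_
      have : j ≠ i := Finset.ne_of_mem_erase hj
      simp [Step.toVec, Pi.single_eq_of_ne this]
    rw [← Finset.mul_prod_erase _ _ (Finset.mem_univ i),
      ← Finset.mul_prod_erase _ (fun j => lineKernel (c j) ((v - Step.toVec (i, false)) j))
        (Finset.mem_univ i), hoff, hoff, ← add_mul, ← mul_assoc]
    refine Eq.trans (congrArg₂ (· * ·) ?_ rfl) (Finset.mul_prod_erase _ _ (Finset.mem_univ i))
    simp [Step.toVec, lineKernel]
    ring

/-- Squaring first (Jensen) replaces the factors `(c i + 1) ^ (-1/2)` by `1 / (c i + 1)`, whose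
multinomial moments are explicitly bounded. -/
theorem heatKernel_sq_le (d : ℕ) [NeZero d] (k : ℕ) (v : Fin d → ℤ) :
    heatKernel d k v ^ 2 ≤ ((d : ℝ) / (k + 1)) ^ d := by
  rw [heatKernel_eq_multiAvg]
  refine (sq_multiAvg_le _ _).trans ?_
  have h := multiAvg_prod_inv_le (ι := Fin d) k Finset.univ
  rw [Finset.card_univ, Fintype.card_fin] at h
  refine (multiAvg_mono _ fun c => ?_).trans h
  rw [← Finset.prod_pow]
  exact Finset.prod_le_prod (fun i _ => sq_nonneg _) fun i _ => lineKernel_sq_le _ _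

theorem sum_heatKernel_le_one (d : ℕ) [NeZero d] (k : ℕ) (A : Finset (Fin d → ℤ))
    (x : Fin d → ℤ) : ∑ y ∈ A, heatKernel d k (y - x) ≤ 1 := by
  have hd : (0 : ℝ) < d := by exact_mod_cast Nat.pos_of_ne_zero (NeZero.ne d)
  induction k generalizing x with
  | zero =>
    simp only [heatKernel, sub_eq_zero, Finset.sum_ite_eq']
    split_ifs <;> norm_num
  | succ k ih =>
    simp only [heatKernel]
    rw [← Finset.sum_div, Finset.sum_comm, div_le_one (by positivity)]
    calc ∑ s : Step d, ∑ y ∈ A, heatKernel d k (y - x - s.toVec) ≤ ∑ _s : Step d, (1 : ℝ) := by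
          gcongr with s
          simp only [sub_sub]
          exact ih _
      _ = 2 * d := by simp [mul_comm]

/-! ### Green kernel and the potential of finite sets -/

section Green

variable {d : ℕ}

/-- The Green kernel of the walk as a real number, `∑ k, p_k(x)`. -/
noncomputable def greenReal (d : ℕ) (x : Fin d → ℤ) : ℝ := ∑' k : ℕ, heatKernel d k x

theorem heatKernel_le_rpow (d : ℕ) [NeZero d] (k : ℕ) (v : Fin d → ℤ) :
    heatKernel d k v ≤ (d : ℝ) ^ ((d : ℝ) / 2) * (1 / ((k : ℝ) + 1) ^ ((d : ℝ) / 2)) := by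
  rw [mul_one_div, ← Real.div_rpow (by positivity) (by positivity)]
  refine le_of_sq_le_sq ?_ (by positivity)
  rw [← Real.rpow_mul_natCast (by positivity)]
  have : (d : ℝ) / 2 * (2 : ℕ) = (d : ℕ) := by push_cast; ring
  rw [this, Real.rpow_natCast]
  exact heatKernel_sq_le d k v

theorem summable_heatKernel (hd : 5 ≤ d) (v : Fin d → ℤ) :
    Summable fun k => heatKernel d k v := by
  have : NeZero d := ⟨by omega⟩
  have hd' : (5 : ℝ) ≤ d := by exact_mod_cast hd
  refine Summable.of_nonneg_of_le (fun k => heatKernel_nonneg d k v)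
    (fun k => heatKernel_le_rpow d k v) (Summable.mul_left _ ?_)
  have h := (summable_nat_add_iff 1).2
    (Real.summable_one_div_nat_rpow (p := (d : ℝ) / 2).2 (by linarith))
  simpa using h

theorem greenReal_nonneg (x : Fin d → ℤ) : 0 ≤ greenReal d x :=
  tsum_nonneg fun k => heatKernel_nonneg d k x

theorem one_le_greenReal_zero (hd : 5 ≤ d) : 1 ≤ greenReal d 0 := by
  have h := (summable_heatKernel hd 0).le_tsum 0 fun k _ => heatKernel_nonneg d k 0
  simpa [heatKernel, greenReal] using h

theorem greenReal_eq (hd : 5 ≤ d) (v : Fin d → ℤ) :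
    greenReal d v = (if v = 0 then 1 else 0) +
      (∑ s : Step d, greenReal d (v - s.toVec)) / (2 * d) := by
  rw [greenReal, (summable_heatKernel hd v).tsum_eq_zero_add]
  congr 1
  simp only [heatKernel, greenReal]
  rw [tsum_div_const, Summable.tsum_finsetSum fun s _ => summable_heatKernel hd _]

/-- The mass of `A` at time `k` is at most `1` and at most a multiple of `|A| * (k + 1) ^ (-d/2)`.
Interpolating with exponent `ρ` leaves a convergent series, because `ρ * d / 2 > 1`. -/
theorem exists_sum_greenReal_le (hd : 5 ≤ d) {ρ : ℝ} (hρ : 2 / (d : ℝ) < ρ) (hρ1 : ρ ≤ 1) :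
    ∃ C : ℝ, 1 ≤ C ∧ ∀ (A : Finset (Fin d → ℤ)) (x : Fin d → ℤ),
      ∑ y ∈ A, greenReal d (y - x) ≤ C * (A.card : ℝ) ^ ρ := by
  have : NeZero d := ⟨by omega⟩
  have hd0 : (0 : ℝ) < d := by exact_mod_cast (by omega : 0 < d)
  have hρ0 : 0 < ρ := lt_trans (by positivity) hρ
  have hsum : Summable fun k : ℕ => 1 / ((k : ℝ) + 1) ^ ((d : ℝ) / 2 * ρ) := by
    have h := (summable_nat_add_iff 1).2
      (Real.summable_one_div_nat_rpow (p := (d : ℝ) / 2 * ρ).2 (by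
        rw [div_lt_iff₀ hd0] at hρ
        linarith))
    simpa using h
  set D : ℝ := (d : ℝ) ^ ((d : ℝ) / 2) with hD
  have hD0 : 0 ≤ D := by positivity
  set T : ℝ := ∑' k : ℕ, 1 / ((k : ℝ) + 1) ^ ((d : ℝ) / 2 * ρ) with hT
  refine ⟨max 1 (D ^ ρ * T), le_max_left _ _, fun A x => ?_⟩
  have hterm : ∀ k : ℕ, ∑ y ∈ A, heatKernel d k (y - x) ≤
      (A.card : ℝ) ^ ρ * D ^ ρ * (1 / ((k : ℝ) + 1) ^ ((d : ℝ) / 2 * ρ)) := by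
    intro k
    set u := ∑ y ∈ A, heatKernel d k (y - x) with hu
    have hu0 : 0 ≤ u := Finset.sum_nonneg fun y _ => heatKernel_nonneg d k _
    have hu1 : u ≤ 1 := sum_heatKernel_le_one d k A x
    have hu2 : u ≤ A.card * (D * (1 / ((k : ℝ) + 1) ^ ((d : ℝ) / 2))) := by
      rw [← nsmul_eq_mul]
      exact Finset.sum_le_card_nsmul _ _ _ fun y _ => heatKernel_le_rpow d k _
    calc u ≤ u ^ ρ := by
          rcases hu0.eq_or_lt with h | h
          · rw [← h, Real.zero_rpow hρ0.ne']
          · simpa using Real.rpow_le_rpow_of_exponent_ge h hu1 hρ1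
      _ ≤ (A.card * (D * (1 / ((k : ℝ) + 1) ^ ((d : ℝ) / 2)))) ^ ρ := by gcongr
      _ = _ := by
        rw [Real.mul_rpow (by positivity) (by positivity), Real.mul_rpow hD0 (by positivity),
          Real.div_rpow (by positivity) (by positivity), Real.one_rpow,
          ← Real.rpow_mul (x := (k : ℝ) + 1) (by positivity), mul_assoc]
  have hs : ∀ y ∈ A, Summable fun k => heatKernel d k (y - x) :=
    fun y _ => summable_heatKernel hd _
  simp only [greenReal]
  rw [← Summable.tsum_finsetSum hs]
  calc ∑' k, ∑ y ∈ A, heatKernel d k (y - x)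
      ≤ ∑' k : ℕ, (A.card : ℝ) ^ ρ * D ^ ρ * (1 / ((k : ℝ) + 1) ^ ((d : ℝ) / 2 * ρ)) :=
        (summable_sum hs).tsum_le_tsum hterm (hsum.mul_left _)
    _ = D ^ ρ * T * (A.card : ℝ) ^ ρ := by rw [tsum_mul_left]; ring
    _ ≤ _ := by gcongr; exact le_max_right _ _

end Green

/-! ### Dependence of the walk on its steps -/

section Walk

variable {d : ℕ}

theorem S_update_of_le {k m : ℕ} (h : m ≤ k) (ω : ℕ → Step d) (s : Step d) :
    S m (Function.update ω k s) = S m ω := by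
  refine Finset.sum_congr rfl fun i hi => ?_
  have : i ≠ k := by
    have := Finset.mem_range.1 hi
    omega
  simp [this]

theorem S_succ_update (k : ℕ) (ω : ℕ → Step d) (s : Step d) :
    S (k + 1) (Function.update ω k s) = S k ω + s.toVec := by
  rw [← S_update_of_le le_rfl ω s, S, Finset.sum_range_succ, S]
  simp

theorem dependsOn_S {k m : ℕ} (h : k ≤ m) :
    DependsOn (S k : (ℕ → Step d) → Fin d → ℤ) (Set.Iio m) := by
  intro ω ω' hω
  refine Finset.sum_congr rfl fun i hi => ?_
  rw [hω i (Set.mem_Iio.2 ((Finset.mem_range.1 hi).trans_le h))]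

end Walk

/-! ### One-step averaging by resampling a coordinate -/

section Resampling

variable {d : ℕ} [NeZero d]

instance : IsProbabilityMeasure (P₀ d) := by
  unfold P₀
  infer_instance

/-- Redrawing one step independently does not change the law; this takes the place of conditional
expectations. -/
theorem map_update_P₀ (k : ℕ) :
    ((P₀ d).prod (uniformOn (Set.univ : Set (Step d)))).map
      (fun p => Function.update p.1 k p.2) = P₀ d := by
  have hm : Measurable fun p : (ℕ → Step d) × Step d => Function.update p.1 k p.2 :=
    measurable_update'
  refine Measure.eq_infinitePi _ fun s t ht => ?_
  have hms : MeasurableSet (Set.pi (s : Set ℕ) t) :=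
    MeasurableSet.pi s.countable_toSet fun i _ => ht i
  rw [Measure.map_apply hm hms]
  have hpre : (fun p : (ℕ → Step d) × Step d => Function.update p.1 k p.2) ⁻¹'
      Set.pi (s : Set ℕ) t =
        Set.pi ((s.erase k : Finset ℕ) : Set ℕ) t ×ˢ (if k ∈ s then t k else Set.univ) := by
    ext ⟨ω, x⟩
    simp only [Set.mem_preimage, Set.mem_pi, Finset.mem_coe, Set.mem_prod, Finset.mem_erase]
    constructor
    · intro h
      refine ⟨fun i hi => by simpa [hi.1] using h i hi.2, ?_⟩
      split_ifs with hk
      · simpa using h k hk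
      · trivial
    · rintro ⟨h1, h2⟩ i hi
      by_cases hik : i = k
      · subst hik
        simpa [hi] using h2
      · simpa [hik] using h1 i ⟨hik, hi⟩
  rw [hpre, Measure.prod_prod, P₀,
    Measure.infinitePi_pi _ fun i _ => ht i]
  split_ifs with hk
  · rw [Finset.prod_erase_mul _ _ hk]
  · rw [Finset.erase_eq_of_notMem hk, measure_univ, mul_one]

theorem lintegral_P₀_eq (k : ℕ) {f : (ℕ → Step d) → ℝ≥0∞} (hf : Measurable f) :
    ∫⁻ ω, f ω ∂(P₀ d) =
      ∫⁻ ω, (∑ s : Step d, f (Function.update ω k s)) / (2 * d : ℝ≥0∞) ∂(P₀ d) := by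
  have hm : Measurable fun p : (ℕ → Step d) × Step d => Function.update p.1 k p.2 :=
    measurable_update'
  conv_lhs => rw [← map_update_P₀ k]
  rw [lintegral_map hf hm, lintegral_prod (fun p => f (Function.update p.1 k p.2)) (hf.comp hm).aemeasurable]
  refine lintegral_congr fun ω => ?_
  rw [lintegral_fintype, ENNReal.div_eq_inv_mul, Finset.mul_sum]
  refine Finset.sum_congr rfl fun s _ => ?_
  rw [uniformOn_univ, mul_comm]
  congr 1
  simp [mul_comm]

theorem measurable_of_dependsOn {β : Type*} [MeasurableSpace β] {k : ℕ} {f : (ℕ → Step d) → β}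
    (hf : DependsOn f (Set.Iio k)) : Measurable f := by
  let e : (Fin k → Step d) → ℕ → Step d := fun w i => if h : i < k then w ⟨i, h⟩ else (0, true)
  have hfe : f = (f ∘ e) ∘ fun ω (i : Fin k) => ω i := by
    ext ω
    refine hf fun i hi => ?_
    simp [e, Set.mem_Iio.1 hi]
  rw [hfe]
  exact (measurable_of_finite _).comp (measurable_pi_lambda _ fun i => measurable_pi_apply _)

theorem lintegral_ofReal_le_of_average_le {k : ℕ} {f g : (ℕ → Step d) → ℝ}
    (hg : DependsOn g (Set.Iio (k + 1))) (hg0 : ∀ ω, 0 ≤ g ω)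
    (h : ∀ ω, (∑ s : Step d, g (Function.update ω k s)) / (2 * d) ≤ f ω) :
    ∫⁻ ω, ENNReal.ofReal (g ω) ∂(P₀ d) ≤ ∫⁻ ω, ENNReal.ofReal (f ω) ∂(P₀ d) := by
  have hd0 : (0 : ℝ) < d := by exact_mod_cast Nat.pos_of_ne_zero (NeZero.ne d)
  rw [lintegral_P₀_eq k (measurable_of_dependsOn hg).ennreal_ofReal]
  refine lintegral_mono fun ω => ?_
  refine le_trans (le_of_eq ?_) (ENNReal.ofReal_le_ofReal (h ω))
  rw [ENNReal.ofReal_div_of_pos (by positivity), ENNReal.ofReal_sum_of_nonneg fun s _ => hg0 _]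
  congr 1
  rw [ENNReal.ofReal_mul (by norm_num)]
  simp

theorem lintegral_S_eq (k : ℕ) (v : Fin d → ℤ) :
    ∫⁻ ω, (if S k ω = v then 1 else 0) ∂(P₀ d) = ENNReal.ofReal (heatKernel d k v) := by
  have hd0 : (0 : ℝ) < d := by exact_mod_cast Nat.pos_of_ne_zero (NeZero.ne d)
  have hmeas : ∀ k v, Measurable fun ω : ℕ → Step d => if S k ω = v then (1 : ℝ≥0∞) else 0 := by
    intro k v
    refine measurable_of_dependsOn (k := k) fun ω ω' h => ?_
    simp only [dependsOn_S le_rfl h]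
  induction k generalizing v with
  | zero =>
    simp only [S, Finset.range_zero, Finset.sum_empty, heatKernel, lintegral_const, measure_univ,
      mul_one, eq_comm (a := (0 : Fin d → ℤ))]
    split_ifs <;> simp
  | succ k ih =>
    rw [lintegral_P₀_eq k (hmeas _ _)]
    simp only [S_succ_update, ← eq_sub_iff_add_eq, ENNReal.div_eq_inv_mul]
    rw [lintegral_const_mul _ (Finset.measurable_sum _ fun s _ => hmeas _ _),
      lintegral_finsetSum _ fun s _ => hmeas _ _]
    simp only [ih]
    rw [heatKernel, ENNReal.ofReal_div_of_pos (by positivity),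
      ENNReal.ofReal_sum_of_nonneg fun s _ => heatKernel_nonneg _ _ _, ENNReal.div_eq_inv_mul,
      ENNReal.ofReal_mul (by norm_num)]
    simp

theorem green_eq_ofReal (hd : 5 ≤ d) (x : Fin d → ℤ) :
    green d x = ENNReal.ofReal (greenReal d x) := by
  simp only [green, totalLocalTime]
  rw [lintegral_tsum]
  · simp only [lintegral_S_eq]
    rw [greenReal, ENNReal.ofReal_tsum_of_nonneg (fun k => heatKernel_nonneg d k x)
      (summable_heatKernel hd x)]
  · intro k
    refine (measurable_of_dependsOn (k := k) fun ω ω' h => ?_).aemeasurable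
    simp only [dependsOn_S le_rfl h]

/-- Only the term `x = 0` of the series is needed. -/
theorem greenReal_sq_lt (hd : 5 ≤ d) {z : ℝ}
    (h : 1 + 2 * ∑' x : Fin d → ℤ, green d x ^ 2 < ENNReal.ofReal z) :
    1 + 2 * greenReal d 0 ^ 2 < z := by
  have h0 := greenReal_nonneg (d := d) 0
  have h1 : ENNReal.ofReal (1 + 2 * greenReal d 0 ^ 2) < ENNReal.ofReal z := by
    refine lt_of_le_of_lt ?_ h
    rw [ENNReal.ofReal_add (by norm_num) (by positivity), ENNReal.ofReal_mul (by norm_num),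
      ENNReal.ofReal_pow h0, ← green_eq_ofReal hd]
    simp only [ENNReal.ofReal_one, ENNReal.ofReal_ofNat]
    gcongr
    exact ENNReal.le_tsum (f := fun x => green d x ^ 2) 0
  exact (ENNReal.ofReal_lt_ofReal_iff_of_nonneg (by positivity)).1 h1

end Resampling

/-! ### Visit ranks and level sets -/

section Occupation

variable {d : ℕ}

theorem localTime_succ (k : ℕ) (ω : ℕ → Step d) (x : Fin d → ℤ) :
    localTime (k + 1) ω x = localTime k ω x + if S (k + 1) ω = x then 1 else 0 := by
  rw [localTime, localTime, Finset.range_add_one (n := k + 1), Finset.filter_insert]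
  split_ifs
  · rw [Finset.card_insert_of_notMem (by simp)]
  · simp

theorem localTime_le (n : ℕ) (ω : ℕ → Step d) (x : Fin d → ℤ) : localTime n ω x ≤ n + 1 :=
  (Finset.card_filter_le _ _).trans (by simp)

theorem localTime_mono {m n : ℕ} (h : m ≤ n) (ω : ℕ → Step d) (x : Fin d → ℤ) :
    localTime m ω x ≤ localTime n ω x := by
  refine Finset.card_le_card (Finset.filter_subset_filter _ ?_)
  exact Finset.range_subset_range.2 (by omega)

/-- The number of visits, up to time `k`, to the site at which the walk is at time `k`. -/
def visitRank (k : ℕ) (ω : ℕ → Step d) : ℕ := localTime k ω (S k ω)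

theorem one_le_visitRank (k : ℕ) (ω : ℕ → Step d) : 1 ≤ visitRank k ω := by
  rw [visitRank, localTime]
  exact Finset.card_pos.2 ⟨k, by simp⟩

/-- The sites visited at least `j` times up to time `k` (for `1 ≤ j`). -/
def levelSet (j k : ℕ) (ω : ℕ → Step d) : Finset (Fin d → ℤ) :=
  ((Finset.range (k + 1)).image fun i => S i ω).filter fun x => j ≤ localTime k ω x

theorem mem_levelSet {j k : ℕ} (hj : 1 ≤ j) {ω : ℕ → Step d} {x : Fin d → ℤ} :
    x ∈ levelSet j k ω ↔ j ≤ localTime k ω x := by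
  rw [levelSet, Finset.mem_filter, and_iff_right_iff_imp]
  intro h
  obtain ⟨i, hi⟩ := Finset.card_pos.1 (hj.trans h)
  rw [Finset.mem_filter] at hi
  exact Finset.mem_image.2 ⟨i, hi.1, hi.2⟩

theorem levelSet_zero {j : ℕ} (hj : 1 ≤ j) (ω : ℕ → Step d) :
    levelSet j 0 ω = if j = 1 then {S 0 ω} else ∅ := by
  ext x
  rw [mem_levelSet hj, localTime]
  simp only [zero_add, Finset.range_one, Finset.filter_singleton]
  by_cases h : S 0 ω = x
  · subst h
    by_cases h1 : j = 1
    · simp [h1]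
    · simp [h1]
      omega
  · by_cases h1 : j = 1
    · simp [h1, h, Ne.symm h]
    · simp [h1, h]
      omega

theorem levelSet_succ_of_visitRank_eq {j k : ℕ} (hj : 1 ≤ j) {ω : ℕ → Step d}
    (h : visitRank (k + 1) ω = j) :
    S (k + 1) ω ∉ levelSet j k ω ∧ levelSet j (k + 1) ω = insert (S (k + 1) ω) (levelSet j k ω) := by
  rw [visitRank, localTime_succ, if_pos rfl] at h
  constructor
  · rw [mem_levelSet hj]
    omega
  · ext x
    rw [Finset.mem_insert, mem_levelSet hj, mem_levelSet hj, localTime_succ]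
    by_cases hx : S (k + 1) ω = x
    · subst hx
      simp
      omega
    · simp [hx, Ne.symm hx]

theorem levelSet_succ_of_visitRank_ne {j k : ℕ} (hj : 1 ≤ j) {ω : ℕ → Step d}
    (h : visitRank (k + 1) ω ≠ j) : levelSet j (k + 1) ω = levelSet j k ω := by
  rw [visitRank, localTime_succ, if_pos rfl] at h
  ext x
  rw [mem_levelSet hj, mem_levelSet hj, localTime_succ]
  by_cases hx : S (k + 1) ω = x
  · subst hx
    simp
    omega
  · simp [hx]

theorem card_levelSet_succ {j : ℕ} (hj : 1 ≤ j) (k : ℕ) (ω : ℕ → Step d) :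
    (levelSet j (k + 1) ω).card =
      (levelSet j k ω).card + if visitRank (k + 1) ω = j then 1 else 0 := by
  split_ifs with h
  · obtain ⟨h1, h2⟩ := levelSet_succ_of_visitRank_eq hj h
    rw [h2, Finset.card_insert_of_notMem h1]
  · rw [levelSet_succ_of_visitRank_ne hj h, add_zero]

/-- Each site of the level set `j` is visited exactly once for the `j`-th time. -/
theorem card_levelSet {j : ℕ} (hj : 1 ≤ j) (n : ℕ) (ω : ℕ → Step d) :
    (levelSet j n ω).card = ((Finset.range (n + 1)).filter fun k => visitRank k ω = j).card := by
  induction n with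
  | zero =>
    have h1 : visitRank 0 ω = 1 :=
      le_antisymm (localTime_le 0 ω _) (one_le_visitRank 0 ω)
    rw [levelSet_zero hj]
    simp only [zero_add, Finset.range_one, Finset.filter_singleton, h1]
    by_cases h : j = 1
    · simp [h]
    · simp [h, Ne.symm h]
  | succ n ih =>
    rw [card_levelSet_succ hj, ih, Finset.range_add_one (n := n + 1), Finset.filter_insert]
    split_ifs
    · rw [Finset.card_insert_of_notMem (by simp)]
    · simp

theorem card_levelSet_anti {i j : ℕ} (h : i ≤ j) (n : ℕ) (ω : ℕ → Step d) :
    (levelSet j n ω).card ≤ (levelSet i n ω).card :=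
  Finset.card_le_card fun x hx => by
    rw [levelSet, Finset.mem_filter] at hx ⊢
    exact ⟨hx.1, h.trans hx.2⟩

/-- The number of times before `k` at which the current site has been visited at least
`j` times. -/
def revisits (j k : ℕ) (ω : ℕ → Step d) : ℕ :=
  ((Finset.range k).filter fun i => j ≤ visitRank i ω).card

theorem revisits_succ (j k : ℕ) (ω : ℕ → Step d) :
    revisits j (k + 1) ω = revisits j k ω + if j ≤ visitRank k ω then 1 else 0 := by
  rw [revisits, revisits, Finset.range_add_one, Finset.filter_insert]
  split_ifs
  · rw [Finset.card_insert_of_notMem (by simp)]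
  · simp

theorem localTime_congr {k m : ℕ} (hm : m ≤ k) {ω ω' : ℕ → Step d}
    (h : ∀ i ∈ Set.Iio k, ω i = ω' i) : localTime m ω = localTime m ω' := by
  ext x
  rw [localTime, localTime]
  congr 1
  refine Finset.filter_congr fun i hi => ?_
  rw [dependsOn_S (show i ≤ k by have := Finset.mem_range.1 hi; omega) h]

theorem visitRank_congr {k m : ℕ} (hm : m ≤ k) {ω ω' : ℕ → Step d}
    (h : ∀ i ∈ Set.Iio k, ω i = ω' i) : visitRank m ω = visitRank m ω' := by
  rw [visitRank, visitRank, localTime_congr hm h, dependsOn_S hm h]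

theorem levelSet_congr {k m : ℕ} (hm : m ≤ k) (j : ℕ) {ω ω' : ℕ → Step d}
    (h : ∀ i ∈ Set.Iio k, ω i = ω' i) : levelSet j m ω = levelSet j m ω' := by
  rw [levelSet, levelSet, localTime_congr hm h]
  congr 1
  refine Finset.image_congr fun i hi => ?_
  exact dependsOn_S (by have := Finset.mem_range.1 hi; omega) h

theorem revisits_congr {k m : ℕ} (hm : m ≤ k + 1) (j : ℕ) {ω ω' : ℕ → Step d}
    (h : ∀ i ∈ Set.Iio k, ω i = ω' i) : revisits j m ω = revisits j m ω' := by
  rw [revisits, revisits]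
  congr 1
  refine Finset.filter_congr fun i hi => ?_
  rw [visitRank_congr (show i ≤ k by have := Finset.mem_range.1 hi; omega) h]

end Occupation

/-! ### Exponential supermartingale for the time spent in a level set -/

section Supermartingale

variable {d : ℕ}

/-- The expected total time which the walk started at `x` spends in `A`. -/
noncomputable def potential (A : Finset (Fin d → ℤ)) (x : Fin d → ℤ) : ℝ :=
  ∑ y ∈ A, greenReal d (y - x)

theorem potential_nonneg (A : Finset (Fin d → ℤ)) (x : Fin d → ℤ) : 0 ≤ potential A x :=
  Finset.sum_nonneg fun _ _ => greenReal_nonneg _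

theorem average_potential (hd : 5 ≤ d) (A : Finset (Fin d → ℤ)) (x : Fin d → ℤ) :
    (∑ s : Step d, potential A (x + s.toVec)) / (2 * d) =
      potential A x - if x ∈ A then 1 else 0 := by
  simp only [potential]
  rw [Finset.sum_comm, Finset.sum_div, eq_sub_iff_add_eq]
  have h : ∀ y ∈ A, greenReal d (y - x) = (if x = y then 1 else 0) +
      (∑ s : Step d, greenReal d (y - (x + s.toVec))) / (2 * d) := by
    intro y _
    rw [greenReal_eq hd (y - x)]
    simp only [sub_sub, sub_eq_zero, eq_comm]
  rw [Finset.sum_congr rfl h, Finset.sum_add_distrib, Finset.sum_ite_eq, add_comm]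

theorem potential_insert (A : Finset (Fin d → ℤ)) {x : Fin d → ℤ} (hx : x ∉ A) :
    potential (insert x A) x = greenReal d 0 + potential A x := by
  rw [potential, Finset.sum_insert hx, sub_self, potential]

/-- An exponential functional of the time spent in the level set `j`, compensated for the growth
of this set and killed when the set has more than `V` elements. -/
noncomputable def levelFunctional (θ : ℝ) (j V k : ℕ) (ω : ℕ → Step d) : ℝ :=
  if (levelSet j k ω).card ≤ V then
    Real.exp (θ * revisits j k ω - 3 / 2 * θ * greenReal d 0 * (levelSet j k ω).card) *
      (1 + 3 / 2 * θ * potential (levelSet j k ω) (S k ω))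
  else 0

theorem levelFunctional_nonneg {θ : ℝ} (hθ : 0 ≤ θ) (j V k : ℕ) (ω : ℕ → Step d) :
    0 ≤ levelFunctional θ j V k ω := by
  rw [levelFunctional]
  have := potential_nonneg (levelSet j k ω) (S k ω)
  split_ifs <;> positivity

theorem dependsOn_levelFunctional (θ : ℝ) (j V k : ℕ) :
    DependsOn (levelFunctional θ j V k : (ℕ → Step d) → ℝ) (Set.Iio k) := by
  intro ω ω' h
  rw [levelFunctional, levelFunctional, levelSet_congr le_rfl j h,
    revisits_congr (Nat.le_succ k) j h, dependsOn_S le_rfl h]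

theorem levelFunctional_zero_le (θ : ℝ) {j : ℕ} (hj : 1 ≤ j) (V : ℕ)
    (ω : ℕ → Step d) : levelFunctional θ j V 0 ω ≤ 1 := by
  rw [levelFunctional, levelSet_zero hj]
  by_cases h1 : j = 1
  · rw [if_pos h1]
    split_ifs
    · simp only [revisits, potential, Finset.range_zero, Finset.filter_empty, Finset.card_empty,
        Finset.card_singleton, Finset.sum_singleton, sub_self, Nat.cast_zero, mul_zero,
        Nat.cast_one, mul_one, zero_sub]
      rw [Real.exp_neg, inv_mul_le_iff₀ (Real.exp_pos _), mul_one, add_comm]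
      exact Real.add_one_le_exp _
    · exact zero_le_one
  · rw [if_neg h1]
    split_ifs
    · simp [revisits, potential]
    · exact zero_le_one

/-- Growth of the level set never helps: a new site at the current position raises the potential
there by `G(0)`, and with `c = 3/2 * θ * G(0)` the compensator gives `exp (-c) * (1 + c + u) ≤ 1 +
u`. So the set may be treated as frozen during a step. -/
theorem levelFunctional_succ_le {θ : ℝ} (hθ : 0 ≤ θ) {j : ℕ} (hj : 1 ≤ j) (V k : ℕ)
    (ω : ℕ → Step d) :
    levelFunctional θ j V (k + 1) ω ≤
      if (levelSet j k ω).card ≤ V then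
        Real.exp (θ * revisits j (k + 1) ω -
          3 / 2 * θ * greenReal d 0 * (levelSet j k ω).card) *
            (1 + 3 / 2 * θ * potential (levelSet j k ω) (S (k + 1) ω))
      else 0 := by
  have hg := greenReal_nonneg (d := d) 0
  have hp := potential_nonneg (levelSet j k ω) (S (k + 1) ω)
  rw [levelFunctional]
  by_cases hr : visitRank (k + 1) ω = j
  · obtain ⟨h1, h2⟩ := levelSet_succ_of_visitRank_eq hj hr
    rw [h2, Finset.card_insert_of_notMem h1, potential_insert _ h1]
    split_ifs with h3 h4 h4
    · push_cast
      set p := potential (levelSet j k ω) (S (k + 1) ω)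
      set c := 3 / 2 * θ * greenReal d 0 with hc
      have hc0 : 0 ≤ c := by positivity
      have e : θ * (revisits j (k + 1) ω : ℝ) - c * (((levelSet j k ω).card : ℝ) + 1) =
          (θ * revisits j (k + 1) ω - c * (levelSet j k ω).card) + -c := by ring
      rw [e, Real.exp_add, mul_assoc]
      gcongr
      rw [Real.exp_neg, inv_mul_le_iff₀ (Real.exp_pos _)]
      have h5 : c + 1 ≤ Real.exp c := Real.add_one_le_exp c
      have h6 : 0 ≤ 3 / 2 * θ * p := by positivity
      nlinarith [mul_nonneg hc0 h6]
    · omega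
    · positivity
    · exact le_rfl
  · rw [levelSet_succ_of_visitRank_ne hj hr]

/-- The factor `3/2` leaves room for the quadratic error of `exp`: `7/6 * (1 + u) ≤ 35/24 < 3/2`. -/
theorem exp_mul_compensated_le {θ u : ℝ} (hθ : 0 ≤ θ) (hθ1 : θ ≤ 1 / 6) (hu0 : 0 ≤ u)
    (hu : u ≤ 1 / 4) : Real.exp θ * (1 + u - 3 / 2 * θ) ≤ 1 + u := by
  have h1 : Real.exp θ ≤ 1 + 7 / 6 * θ := by
    have h := Real.abs_exp_sub_one_sub_id_le (x := θ) (by rw [abs_of_nonneg hθ]; linarith)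
    have := (abs_le.1 h).2
    nlinarith
  calc Real.exp θ * (1 + u - 3 / 2 * θ) ≤ (1 + 7 / 6 * θ) * (1 + u - 3 / 2 * θ) := by
        gcongr
        linarith
    _ ≤ 1 + u := by nlinarith

/-- With the set frozen, a step from inside it gains `exp θ` from the clock and lowers the average
potential by exactly `1`; a step from outside changes neither. -/
theorem average_levelFunctional_le [NeZero d] (hd : 5 ≤ d) {θ : ℝ} (hθ : 0 ≤ θ)
    (hθ1 : θ ≤ 1 / 6) {j : ℕ} (hj : 1 ≤ j) {V : ℕ}
    (hV : ∀ (A : Finset (Fin d → ℤ)) (x : Fin d → ℤ), A.card ≤ V →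
      3 / 2 * θ * potential A x ≤ 1 / 4) (k : ℕ) (ω : ℕ → Step d) :
    (∑ s : Step d, levelFunctional θ j V (k + 1) (Function.update ω k s)) / (2 * d) ≤
      levelFunctional θ j V k ω := by
  have hd0 : (0 : ℝ) < d := by exact_mod_cast Nat.pos_of_ne_zero (NeZero.ne d)
  have hup : ∀ s : Step d, ∀ i ∈ Set.Iio k, Function.update ω k s i = ω i := by
    intro s i hi
    rw [Function.update_of_ne (ne_of_lt hi)]
  have h1 : ∀ s : Step d, levelFunctional θ j V (k + 1) (Function.update ω k s) ≤
      if (levelSet j k ω).card ≤ V then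
        Real.exp (θ * revisits j (k + 1) ω -
          3 / 2 * θ * greenReal d 0 * (levelSet j k ω).card) *
            (1 + 3 / 2 * θ * potential (levelSet j k ω) (S k ω + s.toVec))
      else 0 := by
    intro s
    have h := levelFunctional_succ_le hθ hj V k (Function.update ω k s)
    rwa [levelSet_congr le_rfl j (hup s), revisits_congr le_rfl j (hup s), S_succ_update] at h
  rw [levelFunctional]
  split_ifs with hc
  · simp only [if_pos hc] at h1
    set A := levelSet j k ω
    set c := 3 / 2 * θ * greenReal d 0 * (A.card : ℝ)
    have h2 : (∑ s : Step d, levelFunctional θ j V (k + 1) (Function.update ω k s)) / (2 * d) ≤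
        Real.exp (θ * revisits j (k + 1) ω - c) *
          (1 + 3 / 2 * θ * ((∑ s : Step d, potential A (S k ω + s.toVec)) / (2 * d))) := by
      calc _ ≤ (∑ s : Step d, Real.exp (θ * revisits j (k + 1) ω - c) *
            (1 + 3 / 2 * θ * potential A (S k ω + s.toVec))) / (2 * d) := by
            gcongr with s
            exact h1 s
        _ = _ := by
            rw [← Finset.mul_sum, Finset.sum_add_distrib, ← Finset.mul_sum]
            simp only [Finset.sum_const, Finset.card_univ, Fintype.card_prod, Fintype.card_fin,
              Fintype.card_bool, nsmul_eq_mul]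
            push_cast
            field_simp
    refine h2.trans ?_
    rw [average_potential hd, revisits_succ]
    have hiff : S k ω ∈ A ↔ j ≤ visitRank k ω := mem_levelSet hj
    have hp := potential_nonneg A (S k ω)
    have hu := hV A (S k ω) hc
    by_cases hx : S k ω ∈ A
    · rw [if_pos hx, if_pos (hiff.1 hx)]
      push_cast
      have e : θ * ((revisits j k ω : ℝ) + 1) - c = (θ * revisits j k ω - c) + θ := by ring
      rw [e, Real.exp_add, mul_assoc]
      gcongr
      have h3 := exp_mul_compensated_le hθ hθ1 (by positivity) hu
      calc _ = Real.exp θ * (1 + 3 / 2 * θ * potential A (S k ω) - 3 / 2 * θ) := by ring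
        _ ≤ _ := h3
    · rw [if_neg hx, if_neg (fun h => hx (hiff.2 h)), add_zero, sub_zero]
  · simp only [if_neg hc] at h1
    exact div_nonpos_of_nonpos_of_nonneg (Finset.sum_nonpos fun s _ => h1 s) (by positivity)

theorem lintegral_levelFunctional_le [NeZero d] (hd : 5 ≤ d) {θ : ℝ} (hθ : 0 ≤ θ)
    (hθ1 : θ ≤ 1 / 6) {j : ℕ} (hj : 1 ≤ j) {V : ℕ}
    (hV : ∀ (A : Finset (Fin d → ℤ)) (x : Fin d → ℤ), A.card ≤ V →
      3 / 2 * θ * potential A x ≤ 1 / 4) (k : ℕ) :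
    ∫⁻ ω, ENNReal.ofReal (levelFunctional θ j V k ω) ∂(P₀ d) ≤ 1 := by
  induction k with
  | zero =>
    calc ∫⁻ ω, ENNReal.ofReal (levelFunctional θ j V 0 ω) ∂(P₀ d) ≤ ∫⁻ _, 1 ∂(P₀ d) :=
          lintegral_mono fun ω => ENNReal.ofReal_le_one.2 (levelFunctional_zero_le θ hj V ω)
      _ = 1 := by simp
  | succ k ih =>
    exact (lintegral_ofReal_le_of_average_le (dependsOn_levelFunctional θ j V (k + 1))
      (levelFunctional_nonneg hθ j V (k + 1))
      (average_levelFunctional_le hd hθ hθ1 hj hV k)).trans ih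

/-- The time spent at sites which have already been visited `j` times is, up to a large deviation,
at most a multiple of the number of these sites. -/
theorem measure_revisits_le [NeZero d] (hd : 5 ≤ d) {ρ C : ℝ} (hC1 : 1 ≤ C)
    (hρ : 0 ≤ ρ) (hC : ∀ (A : Finset (Fin d → ℤ)) (x : Fin d → ℤ),
      potential A x ≤ C * (A.card : ℝ) ^ ρ) {j : ℕ} (hj : 1 ≤ j) {V : ℕ} (hV : 1 ≤ V) (n : ℕ)
    {E : ℝ} :
    (P₀ d).real {ω | (levelSet j n ω).card = V ∧
        3 / 2 * greenReal d 0 * V + E * (V : ℝ) ^ ρ ≤ revisits j (n + 1) ω} ≤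
      2 * Real.exp (-(E / (6 * C))) := by
  have hV1 : (1 : ℝ) ≤ (V : ℝ) ^ ρ := Real.one_le_rpow (by exact_mod_cast hV) hρ
  -- The largest `θ` for which the potential bound gives `3/2 * θ * potential ≤ 1/4` on sets of size
  -- at most `V`.
  set θ : ℝ := 1 / (6 * C * (V : ℝ) ^ ρ) with hθd
  have hCV : 1 ≤ C * (V : ℝ) ^ ρ := by nlinarith
  have hθ : 0 < θ := by positivity
  have hθ1 : θ ≤ 1 / 6 := by
    rw [hθd, mul_assoc]
    gcongr
    linarith
  have hbound : ∀ (A : Finset (Fin d → ℤ)) (x : Fin d → ℤ), A.card ≤ V →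
      3 / 2 * θ * potential A x ≤ 1 / 4 := by
    intro A x hA
    calc 3 / 2 * θ * potential A x ≤ 3 / 2 * θ * (C * (V : ℝ) ^ ρ) := by
          gcongr
          refine (hC A x).trans ?_
          gcongr
      _ = 1 / 4 := by
          rw [hθd]
          field_simp
          norm_num
  have hint := lintegral_levelFunctional_le hd hθ.le hθ1 hj hbound n
  set a : ℝ := Real.exp (E / (6 * C)) / 2 with ha
  have ha0 : 0 < a := by positivity
  have hsub : {ω : ℕ → Step d | (levelSet j n ω).card = V ∧
      3 / 2 * greenReal d 0 * V + E * (V : ℝ) ^ ρ ≤ revisits j (n + 1) ω} ⊆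
        {ω | ENNReal.ofReal a ≤ ENNReal.ofReal (levelFunctional θ j V n ω)} := by
    rintro ω ⟨h1, h2⟩
    refine ENNReal.ofReal_le_ofReal ?_
    rw [levelFunctional, if_pos h1.le, h1]
    -- The functional at time `n` does not count the visit at time `n` itself. This costs `exp (-θ)
    -- ≥ 1/2`, whence the factor `2` in the bound.
    have hN : (revisits j (n + 1) ω : ℝ) ≤ revisits j n ω + 1 := by
      rw [revisits_succ]
      split_ifs <;> simp
    have hp := potential_nonneg (levelSet j n ω) (S n ω)
    have hlog : Real.exp (-θ) ≥ 1 / 2 := by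
      have := Real.add_one_le_exp (-θ)
      linarith
    have hEθ : θ * (E * (V : ℝ) ^ ρ) = E / (6 * C) := by
      rw [hθd]
      field_simp
    have h3 : E / (6 * C) + -θ ≤ θ * revisits j n ω - 3 / 2 * θ * greenReal d 0 * V := by
      rw [← hEθ]
      nlinarith
    calc a = Real.exp (E / (6 * C)) * (1 / 2) := by rw [ha]; ring
      _ ≤ Real.exp (E / (6 * C)) * Real.exp (-θ) := by gcongr
      _ ≤ Real.exp (θ * revisits j n ω - 3 / 2 * θ * greenReal d 0 * V) := by
          rw [← Real.exp_add]
          exact Real.exp_le_exp.2 h3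
      _ ≤ _ := le_mul_of_one_le_right (Real.exp_nonneg _)
          (by have : 0 ≤ 3 / 2 * θ * potential (levelSet j n ω) (S n ω) := by positivity
              linarith)
  have hmark := meas_ge_le_lintegral_div (μ := P₀ d)
    (measurable_of_dependsOn (dependsOn_levelFunctional θ j V n)).ennreal_ofReal.aemeasurable
    (ENNReal.ofReal_pos.2 ha0).ne' ENNReal.ofReal_ne_top
  have h4 : P₀ d {ω : ℕ → Step d | (levelSet j n ω).card = V ∧
      3 / 2 * greenReal d 0 * V + E * (V : ℝ) ^ ρ ≤ revisits j (n + 1) ω} ≤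
        ENNReal.ofReal (1 / a) := by
    refine (measure_mono hsub).trans (hmark.trans ?_)
    rw [ENNReal.ofReal_div_of_pos ha0, ENNReal.ofReal_one]
    gcongr
  calc _ ≤ 1 / a := ENNReal.toReal_le_of_le_ofReal (by positivity) h4
    _ = _ := by
      rw [ha, Real.exp_neg]
      field_simp

end Supermartingale

/-! ### From self-intersections to level sets -/

section Counting

variable {d : ℕ}

theorem sq_localTime_eq (n : ℕ) (ω : ℕ → Step d) (x : Fin d → ℤ) :
    (localTime n ω x : ℝ) ^ 2 =
      ∑ k ∈ Finset.range (n + 1), if S k ω = x then 2 * (visitRank k ω : ℝ) - 1 else 0 := by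
  induction n with
  | zero =>
    rw [zero_add, Finset.sum_range_one, visitRank, localTime, localTime]
    simp only [zero_add, Finset.range_one, Finset.filter_singleton]
    split_ifs <;> norm_num
  | succ n ih =>
    rw [Finset.sum_range_succ, ← ih, localTime_succ]
    split_ifs with h
    · subst h
      rw [visitRank, localTime_succ, if_pos rfl]
      push_cast
      ring
    · simp

/-- At a low site every visit has rank at most `J`; visits of such rank to other sites only add
nonnegative terms. -/
theorem lowSum_le_sum_range {b : ℝ} {n J : ℕ} (ω : ℕ → Step d)
    (hJ : ∀ l : ℕ, l ≤ n + 1 → (l : ℝ) ≤ (n : ℝ) ^ b → l ≤ J) :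
    lowSum b n ω ≤ ∑ k ∈ Finset.range (n + 1),
      if visitRank k ω ≤ J then 2 * (visitRank k ω : ℝ) - 1 else 0 := by
  classical
  have hpos : ∀ k, 0 ≤ 2 * (visitRank k ω : ℝ) - 1 := by
    intro k
    have : (1 : ℝ) ≤ visitRank k ω := by exact_mod_cast one_le_visitRank k ω
    linarith
  set R : Finset (Fin d → ℤ) := (Finset.range (n + 1)).image fun k => S k ω with hR
  have h1 : lowSum b n ω = ∑ x ∈ R,
      (lowSites b n ω).indicator (fun x => (localTime n ω x : ℝ) ^ 2) x := by
    rw [lowSum, tsum_subtype (lowSites b n ω) (fun x => (localTime n ω x : ℝ) ^ 2)]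
    refine tsum_eq_sum fun x hx => ?_
    have h0 : localTime n ω x = 0 := by
      rw [localTime, Finset.card_eq_zero, Finset.filter_eq_empty_iff]
      exact fun k hk hkx => hx (Finset.mem_image.2 ⟨k, hk, hkx⟩)
    simp [Set.indicator_apply, h0]
  rw [h1]
  calc ∑ x ∈ R, (lowSites b n ω).indicator (fun x => (localTime n ω x : ℝ) ^ 2) x
      ≤ ∑ x ∈ R, ∑ k ∈ Finset.range (n + 1), if S k ω = x then
          (if visitRank k ω ≤ J then 2 * (visitRank k ω : ℝ) - 1 else 0) else 0 := by
        refine Finset.sum_le_sum fun x _ => ?_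
        by_cases hx : x ∈ lowSites b n ω
        · rw [Set.indicator_of_mem hx, sq_localTime_eq]
          refine Finset.sum_le_sum fun k hk => ?_
          split_ifs with h2 h3
          · exact le_rfl
          · refine absurd ?_ h3
            have hle : visitRank k ω ≤ localTime n ω x := by
              rw [visitRank, h2]
              exact localTime_mono (by have := Finset.mem_range.1 hk; omega) ω x
            exact hle.trans (hJ _ (localTime_le n ω x) hx)
          · exact le_rfl
        · rw [Set.indicator_of_notMem hx]
          refine Finset.sum_nonneg fun k _ => ?_
          have := hpos k
          split_ifs <;> simp_all
    _ = _ := by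
        rw [Finset.sum_comm]
        refine Finset.sum_congr rfl fun k hk => ?_
        rw [Finset.sum_ite_eq, if_pos (Finset.mem_image.2 ⟨k, hk, rfl⟩)]

theorem lowSum_le {b : ℝ} {n J : ℕ} (ω : ℕ → Step d)
    (hJ : ∀ l : ℕ, l ≤ n + 1 → (l : ℝ) ≤ (n : ℝ) ^ b → l ≤ J) :
    lowSum b n ω ≤ ∑ j ∈ Finset.Icc 1 J, (2 * (j : ℝ) - 1) * (levelSet j n ω).card := by
  refine (lowSum_le_sum_range ω hJ).trans (le_of_eq ?_)
  have h : ∀ k, (if visitRank k ω ≤ J then 2 * (visitRank k ω : ℝ) - 1 else 0) =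
      ∑ j ∈ Finset.Icc 1 J, if visitRank k ω = j then 2 * (j : ℝ) - 1 else 0 := by
    intro k
    rw [Finset.sum_ite_eq]
    simp [one_le_visitRank]
  simp only [h]
  rw [Finset.sum_comm]
  refine Finset.sum_congr rfl fun j hj => ?_
  rw [card_levelSet (Finset.mem_Icc.1 hj).1, ← Finset.sum_filter, Finset.sum_const, nsmul_eq_mul,
    mul_comm]

theorem sum_card_levelSet_le {j : ℕ} (hj : 1 ≤ j) (J n : ℕ) (ω : ℕ → Step d) :
    ∑ i ∈ Finset.Icc j J, (levelSet i n ω).card ≤ revisits j (n + 1) ω := by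
  have h1 : ∀ i ∈ Finset.Icc j J, (levelSet i n ω).card =
      (((Finset.range (n + 1)).filter fun k => visitRank k ω ∈ Finset.Icc j J).filter
        fun k => visitRank k ω = i).card := by
    intro i hi
    rw [card_levelSet (hj.trans (Finset.mem_Icc.1 hi).1), Finset.filter_filter]
    congr 1
    refine Finset.filter_congr fun k _ => ?_
    constructor
    · intro h
      exact ⟨h ▸ hi, h⟩
    · exact fun h => h.2
  have h2 := Finset.card_eq_sum_card_fiberwise (f := fun k => visitRank k ω)
    (s := (Finset.range (n + 1)).filter fun k => visitRank k ω ∈ Finset.Icc j J)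
    (t := Finset.Icc j J) fun k hk => (Finset.mem_filter.1 hk).2
  rw [Finset.sum_congr rfl h1, ← h2]
  refine Finset.card_le_card fun k hk => ?_
  rw [Finset.mem_filter, Finset.mem_Icc] at hk
  exact Finset.mem_filter.2 ⟨hk.1, hk.2.1⟩

theorem revisits_le (j k : ℕ) (ω : ℕ → Step d) : revisits j k ω ≤ k :=
  (Finset.card_filter_le _ _).trans (by simp)

end Counting

/-! ### The deterministic inequality between level sizes -/

section Levels

theorem sum_rpow_neg_le {s : ℝ} (hs0 : 0 ≤ s) (hs : s < 1) (J : ℕ) :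
    ∑ j ∈ Finset.Icc 1 J, (j : ℝ) ^ (-s) ≤ (J : ℝ) ^ (1 - s) / (1 - s) := by
  have h1s : 0 < 1 - s := by linarith
  induction J with
  | zero => simp [Real.zero_rpow h1s.ne']
  | succ J ih =>
    rw [Finset.sum_Icc_succ_top (by omega)]
    refine (add_le_add_left ih _).trans ?_
    have hJ : (0 : ℝ) < (J : ℝ) + 1 := by positivity
    push_cast
    have hb := rpow_one_add_le_one_add_mul_self (s := -(1 / ((J : ℝ) + 1))) (p := 1 - s)
      (by
        rw [neg_le_neg_iff, div_le_one hJ]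
        have : (0 : ℝ) ≤ J := by positivity
        linarith) h1s.le (by linarith)
    have e1 : (1 + -(1 / ((J : ℝ) + 1))) = J / (J + 1) := by
      field_simp
      ring
    -- Bernoulli's inequality for the concave power `1 - s` bounds the new term by the increment of
    -- `J ^ (1 - s) / (1 - s)`.
    rw [e1, Real.div_rpow (by positivity) hJ.le, div_le_iff₀ (by positivity)] at hb
    have e2 : ((J : ℝ) + 1) ^ (1 - s) = (J + 1) * ((J : ℝ) + 1) ^ (-s) := by
      rw [sub_eq_add_neg, Real.rpow_add hJ, Real.rpow_one]
    rw [div_add' _ _ _ h1s.ne']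
    gcongr
    rw [e2] at hb ⊢
    have e3 : (1 + (1 - s) * -(1 / ((J : ℝ) + 1))) * ((J + 1) * ((J : ℝ) + 1) ^ (-s)) =
        (J + 1) * ((J : ℝ) + 1) ^ (-s) - (1 - s) * ((J : ℝ) + 1) ^ (-s) := by
      field_simp
      ring
    rw [e3] at hb
    linarith

theorem weighted_sum_le {V : ℕ → ℝ} (hV0 : ∀ j, 0 ≤ V j) (hV : ∀ i j, i ≤ j → V j ≤ V i)
    {J : ℕ} {C E ρ : ℝ} (hE : 0 ≤ E) (hρ0 : 0 ≤ ρ) (hρ : 2 * ρ < 1)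
    (h : ∀ j ∈ Finset.Icc 1 J, ∑ i ∈ Finset.Icc j J, V i ≤ C * V j + E * V j ^ ρ) :
    ∑ j ∈ Finset.Icc 1 J, (j : ℝ) * V j ≤ C * ∑ j ∈ Finset.Icc 1 J, V j +
      E * ((2 * ∑ j ∈ Finset.Icc 1 J, (j : ℝ) * V j) ^ ρ *
        ((J : ℝ) ^ (1 - 2 * ρ) / (1 - 2 * ρ))) := by
  set X := ∑ j ∈ Finset.Icc 1 J, (j : ℝ) * V j with hX
  have hX0 : 0 ≤ X := Finset.sum_nonneg fun j _ => mul_nonneg (by positivity) (hV0 j)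
  have h1 : X = ∑ j ∈ Finset.Icc 1 J, ∑ i ∈ Finset.Icc j J, V i := by
    rw [Finset.sum_comm' (t' := Finset.Icc 1 J) (s' := fun i => Finset.Icc 1 i)]
    · refine Finset.sum_congr rfl fun i _ => ?_
      simp
    · intro i j
      simp only [Finset.mem_Icc]
      omega
  -- Monotonicity of `V` gives `X ≥ V j * (1 + … + j)`, so `V j ≤ 2 X / j ^ 2`.
  have h2 : ∀ j ∈ Finset.Icc 1 J, V j ^ ρ ≤ (2 * X) ^ ρ * (j : ℝ) ^ (-(2 * ρ)) := by
    intro j hj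
    rw [Finset.mem_Icc] at hj
    have hj0 : (0 : ℝ) < j := by exact_mod_cast hj.1
    have h3 : V j * ((j : ℝ) * (j + 1) / 2) ≤ X := by
      have hgauss : ∑ i ∈ Finset.Icc 1 j, (i : ℝ) = (j : ℝ) * (j + 1) / 2 := by
        clear hj hj0
        induction j with
        | zero => simp
        | succ j ih =>
          rw [Finset.sum_Icc_succ_top (by omega), ih]
          push_cast
          ring
      calc V j * ((j : ℝ) * (j + 1) / 2) = ∑ i ∈ Finset.Icc 1 j, (i : ℝ) * V j := by
            rw [← hgauss, Finset.mul_sum]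
            exact Finset.sum_congr rfl fun i _ => mul_comm _ _
        _ ≤ ∑ i ∈ Finset.Icc 1 j, (i : ℝ) * V i := by
            refine Finset.sum_le_sum fun i hi => ?_
            exact mul_le_mul_of_nonneg_left (hV i j (Finset.mem_Icc.1 hi).2) (by positivity)
        _ ≤ X := by
            refine Finset.sum_le_sum_of_subset_of_nonneg
              (Finset.Icc_subset_Icc le_rfl hj.2) fun i _ _ => ?_
            exact mul_nonneg (by positivity) (hV0 i)
    have h4 : V j ≤ 2 * X * (j : ℝ) ^ (-2 : ℝ) := by
      rw [Real.rpow_neg hj0.le, ← div_eq_mul_inv, le_div_iff₀ (by positivity)]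
      norm_num
      nlinarith [mul_nonneg (hV0 j) hj0.le]
    calc V j ^ ρ ≤ (2 * X * (j : ℝ) ^ (-2 : ℝ)) ^ ρ :=
          Real.rpow_le_rpow (hV0 j) h4 hρ0
      _ = _ := by
          rw [Real.mul_rpow (by positivity) (by positivity), ← Real.rpow_mul hj0.le]
          congr 2
          ring
  calc X ≤ ∑ j ∈ Finset.Icc 1 J, (C * V j + E * V j ^ ρ) := by
        rw [h1]
        exact Finset.sum_le_sum h
    _ = C * ∑ j ∈ Finset.Icc 1 J, V j + E * ∑ j ∈ Finset.Icc 1 J, V j ^ ρ := by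
        rw [Finset.sum_add_distrib, Finset.mul_sum, Finset.mul_sum]
    _ ≤ _ := by
        gcongr
        calc ∑ j ∈ Finset.Icc 1 J, V j ^ ρ
            ≤ ∑ j ∈ Finset.Icc 1 J, (2 * X) ^ ρ * (j : ℝ) ^ (-(2 * ρ)) := Finset.sum_le_sum h2
          _ = (2 * X) ^ ρ * ∑ j ∈ Finset.Icc 1 J, (j : ℝ) ^ (-(2 * ρ)) := by
              rw [← Finset.mul_sum]
          _ ≤ _ := by
              gcongr
              exact sum_rpow_neg_le (by positivity) hρ J

end Levels

/-! ### Asymptotics and choice of exponents -/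

section Asymptotics

open Filter Topology

theorem eventually_union_bound_le {b κ ζ σ : ℝ} (hb : b ≤ 2) (hκ : 0 < κ) (hσ : 0 < σ)
    (hζ : ζ < σ) :
    ∀ᶠ n : ℕ in atTop, (n : ℝ) ^ b * ((n + 1) * (2 * Real.exp (-(κ * (n : ℝ) ^ σ)))) ≤
      Real.exp (-1 * (n : ℝ) ^ ζ) := by
  -- The polynomial prefactor will be at most `n ^ 5`, so `κ / 10` makes it cost half of the
  -- exponent.
  have hlog : ∀ᶠ x : ℝ in atTop, ‖Real.log x‖ ≤ κ / 10 * ‖x ^ σ‖ :=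
    (isLittleO_log_rpow_atTop hσ).bound (by positivity)
  have hpow : ∀ᶠ x : ℝ in atTop, x ^ (-(σ - ζ)) < κ / 2 :=
    (tendsto_rpow_neg_atTop (sub_pos.2 hζ)).eventually (gt_mem_nhds (by positivity))
  filter_upwards [tendsto_natCast_atTop_atTop.eventually hlog,
    tendsto_natCast_atTop_atTop.eventually hpow, eventually_ge_atTop 2] with n h1 h2 hn
  have hn2 : (2 : ℝ) ≤ n := by exact_mod_cast hn
  have hn0 : (0 : ℝ) < n := by linarith
  have hσn : 0 < (n : ℝ) ^ σ := by positivity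
  rw [Real.norm_of_nonneg (Real.log_nonneg (by linarith)), Real.norm_of_nonneg hσn.le] at h1
  have h3 : (n : ℝ) ^ ζ ≤ κ / 2 * (n : ℝ) ^ σ := by
    have e : (n : ℝ) ^ ζ = (n : ℝ) ^ (-(σ - ζ)) * (n : ℝ) ^ σ := by
      rw [← Real.rpow_add hn0]
      congr 1
      ring
    rw [e]
    gcongr
  have h4 : (n : ℝ) ^ b * ((n + 1) * 2) ≤ Real.exp (κ / 2 * (n : ℝ) ^ σ) := by
    calc (n : ℝ) ^ b * ((n + 1) * 2) ≤ (n : ℝ) ^ (2 : ℝ) * ((n + 1) * 2) := by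
          gcongr
          linarith
      _ ≤ (n : ℝ) ^ 2 * (n : ℝ) ^ 3 := by
          rw [Real.rpow_two]
          gcongr
          nlinarith [mul_nonneg hn0.le (sub_nonneg.2 hn2)]
      _ = Real.exp (5 * Real.log n) := by
          rw [← pow_add, ← Real.rpow_natCast, Real.rpow_def_of_pos hn0]
          congr 1
          push_cast
          ring
      _ ≤ _ := by
          apply Real.exp_le_exp.2
          linarith
  calc (n : ℝ) ^ b * ((n + 1) * (2 * Real.exp (-(κ * (n : ℝ) ^ σ))))
      = (n : ℝ) ^ b * ((n + 1) * 2) * Real.exp (-(κ * (n : ℝ) ^ σ)) := by ring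
    _ ≤ Real.exp (κ / 2 * (n : ℝ) ^ σ) * Real.exp (-(κ * (n : ℝ) ^ σ)) := by gcongr
    _ ≤ _ := by
        rw [← Real.exp_add]
        apply Real.exp_le_exp.2
        linarith

theorem eventually_growth {γ z D : ℝ} (h : (γ = 1 ∧ D < z) ∨ (1 < γ ∧ 0 < z))
    {ε : ℕ → ℝ} (hε : Tendsto ε atTop (𝓝 0)) :
    ∀ᶠ n : ℕ in atTop, ε n ≤ 1 ∧
      (D + ε n) * (n + 1) < (1 - ε n) * ((n : ℝ) ^ γ * z) := by
  obtain ⟨z', hz', hz'n⟩ : ∃ z', D < z' ∧ ∀ᶠ n : ℕ in atTop, z' * n ≤ (n : ℝ) ^ γ * z := by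
    rcases h with ⟨rfl, hz⟩ | ⟨hγ, hz⟩
    · refine ⟨z, hz, Eventually.of_forall fun n => ?_⟩
      rw [Real.rpow_one, mul_comm]
    · refine ⟨D + 1, by linarith, ?_⟩
      have h1 := (tendsto_rpow_atTop (sub_pos.2 hγ)).comp tendsto_natCast_atTop_atTop
        |>.eventually (eventually_ge_atTop ((D + 1) / z))
      filter_upwards [h1, eventually_ge_atTop 1] with n hn hn1
      have hn0 : (0 : ℝ) < n := by exact_mod_cast hn1
      simp only [Function.comp_apply] at hn
      rw [div_le_iff₀ hz] at hn
      have e : (n : ℝ) ^ γ = (n : ℝ) ^ (γ - 1) * n := by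
        rw [Real.rpow_sub_one hn0.ne']
        field_simp
      rw [e]
      nlinarith
  have hinv : Tendsto (fun n : ℕ => 1 / (n : ℝ)) atTop (𝓝 0) := tendsto_one_div_atTop_nhds_zero_nat
  have hlim : Tendsto (fun n : ℕ => (D + ε n) * (1 + 1 / (n : ℝ)) - (1 - ε n) * z') atTop
      (𝓝 ((D + 0) * (1 + 0) - (1 - 0) * z')) :=
    ((hε.const_add D).mul (hinv.const_add 1)).sub ((hε.const_sub 1).mul_const z')
  have hneg := hlim.eventually (gt_mem_nhds (show (D + 0) * (1 + 0) - (1 - 0) * z' < 0 by linarith))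
  filter_upwards [hneg, hz'n, hε.eventually (gt_mem_nhds (show (0 : ℝ) < 1 by norm_num)),
    eventually_ge_atTop 1] with n h1 h2 h3 hn1
  refine ⟨h3.le, ?_⟩
  have hn0 : (0 : ℝ) < n := by exact_mod_cast hn1
  have h4 := mul_neg_of_neg_of_pos h1 hn0
  have e : ((D + ε n) * (1 + 1 / (n : ℝ)) - (1 - ε n) * z') * n =
      (D + ε n) * (n + 1) - (1 - ε n) * (z' * n) := by
    field_simp
  rw [e] at h4
  have h5 := mul_le_mul_of_nonneg_left h2 (sub_nonneg.2 h3.le)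
  linarith

theorem exists_exponent {d : ℕ} (hd : 5 ≤ d) {b γ ζ : ℝ} (hγ : 1 ≤ γ) (hb : b ≤ 1 + 1 / (d : ℝ))
    (hζ : ζ < γ - b - 2 / (d : ℝ) * (γ - 2 * b)) :
    ∃ ρ σ : ℝ, 2 / (d : ℝ) < ρ ∧ 2 * ρ < 1 ∧ 0 < σ ∧ ζ < σ ∧ σ < γ - b - ρ * (γ - 2 * b) := by
  have hd5 : (5 : ℝ) ≤ d := by exact_mod_cast hd
  have ht : 1 / (d : ℝ) ≤ 1 / 5 := by gcongr
  have ht0 : 0 < 1 / (d : ℝ) := by positivity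
  have e : 2 / (d : ℝ) = 2 * (1 / (d : ℝ)) := by ring
  -- The exponent increases in `γ` and decreases in `b`; at the extreme `γ = 1`, `b = 1 + t`, with
  -- `t = 1/d`, it equals `t + 4 t ^ 2 > 0`.
  have hpos : max ζ 0 < γ - b - 2 / (d : ℝ) * (γ - 2 * b) := by
    refine max_lt hζ ?_
    rw [e]
    set t := 1 / (d : ℝ)
    have h1 : b * (1 - 4 * t) ≤ (1 + t) * (1 - 4 * t) := by gcongr; linarith
    have h2 : 1 * (1 - 2 * t) ≤ γ * (1 - 2 * t) := by gcongr; linarith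
    nlinarith
  have hcont : ContinuousAt (fun ρ : ℝ => γ - b - ρ * (γ - 2 * b)) (2 / (d : ℝ)) := by fun_prop
  have h1 : ∀ᶠ ρ : ℝ in 𝓝[>] (2 / (d : ℝ)), max ζ 0 < γ - b - ρ * (γ - 2 * b) :=
    nhdsWithin_le_nhds (hcont.eventually (lt_mem_nhds hpos))
  have h2 : ∀ᶠ ρ : ℝ in 𝓝[>] (2 / (d : ℝ)), ρ < 1 / 2 :=
    nhdsWithin_le_nhds (gt_mem_nhds (by rw [e]; linarith))
  obtain ⟨ρ, ⟨h3, h4⟩, h5⟩ := ((h1.and h2).and self_mem_nhdsWithin).exists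
  obtain ⟨σ, h6, h7⟩ := exists_between h3
  exact ⟨ρ, σ, h5, by linarith, (le_max_right _ _).trans_lt h6, (le_max_left _ _).trans_lt h6, h7⟩

end Asymptotics

/-! ### Combining the deterministic and probabilistic bounds -/

section Main

open Filter Topology

variable {d : ℕ}

theorem growth_bound {X Y D ε m w : ℝ} (hX : X ≤ D * Y + ε * X) (hw : w ≤ 2 * X - Y)
    (hY : Y ≤ m) (hε0 : 0 ≤ ε) (hε : ε ≤ 1) (hD : 1 ≤ 2 * D) :
    (1 - ε) * w ≤ (2 * D - 1 + ε) * m := by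
  have h1 := mul_le_mul_of_nonneg_left hw (sub_nonneg.2 hε)
  have h2 : (2 * D - 1 + ε) * Y ≤ (2 * D - 1 + ε) * m :=
    mul_le_mul_of_nonneg_left hY (by linarith)
  nlinarith

/-- The deterministic part: if the time spent at sites visited at least `j` times is controlled
by their number, for all `1 ≤ j ≤ J`, then the self-intersections of low sites are controlled. -/
theorem growth_bound_of_revisits_le {b D E ρ w : ℝ} {n J : ℕ} {ω : ℕ → Step d}
    (hJ : ∀ l : ℕ, l ≤ n + 1 → (l : ℝ) ≤ (n : ℝ) ^ b → l ≤ J)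
    (hE : 0 ≤ E) (hD : 1 ≤ 2 * D) (hρ0 : 0 ≤ ρ) (hρ : 2 * ρ < 1)
    (hgood : ∀ j ∈ Finset.Icc 1 J, 1 ≤ (levelSet j n ω).card →
      (revisits j (n + 1) ω : ℝ) ≤ D * (levelSet j n ω).card + E * ((levelSet j n ω).card : ℝ) ^ ρ)
    (hw0 : 0 < w) (hw : w ≤ lowSum b n ω)
    (hε1 : 2 * E * w ^ (ρ - 1) * ((J : ℝ) ^ (1 - 2 * ρ) / (1 - 2 * ρ)) ≤ 1) :
    (1 - 2 * E * w ^ (ρ - 1) * ((J : ℝ) ^ (1 - 2 * ρ) / (1 - 2 * ρ))) * w ≤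
      (2 * D - 1 + 2 * E * w ^ (ρ - 1) * ((J : ℝ) ^ (1 - 2 * ρ) / (1 - 2 * ρ))) * (n + 1) := by
  set V : ℕ → ℝ := fun j => ((levelSet j n ω).card : ℝ) with hV
  set X := ∑ j ∈ Finset.Icc 1 J, (j : ℝ) * V j with hX
  set Y := ∑ j ∈ Finset.Icc 1 J, V j with hY
  have hV0 : ∀ j, 0 ≤ V j := fun j => by positivity
  have hanti : ∀ i j, i ≤ j → V j ≤ V i := fun i j hij =>
    Nat.cast_le.2 (card_levelSet_anti hij n ω)
  have hY0 : 0 ≤ Y := Finset.sum_nonneg fun j _ => hV0 j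
  have hwX : w ≤ 2 * X - Y := by
    refine (hw.trans (lowSum_le ω hJ)).trans (le_of_eq ?_)
    rw [hX, hY, Finset.mul_sum, ← Finset.sum_sub_distrib]
    exact Finset.sum_congr rfl fun j _ => by ring
  have hYn : Y ≤ n + 1 := by
    have h := (sum_card_levelSet_le le_rfl J n ω).trans (revisits_le 1 (n + 1) ω)
    have h' : ((∑ j ∈ Finset.Icc 1 J, (levelSet j n ω).card : ℕ) : ℝ) ≤ ((n + 1 : ℕ) : ℝ) := by
      exact_mod_cast h
    push_cast at h'
    exact h'
  have hlevel : ∀ j ∈ Finset.Icc 1 J, ∑ i ∈ Finset.Icc j J, V i ≤ D * V j + E * V j ^ ρ := by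
    intro j hj
    rcases Nat.eq_zero_or_pos (levelSet j n ω).card with h0 | h0
    · have hz : ∀ i ∈ Finset.Icc j J, V i = 0 := fun i hi => by
        have := card_levelSet_anti (Finset.mem_Icc.1 hi).1 n ω
        have h1 : (levelSet i n ω).card = 0 := by omega
        simp [hV, h1]
      rw [Finset.sum_eq_zero hz]
      have hVj : V j = 0 := by simp [hV, h0]
      rw [hVj, mul_zero, zero_add]
      exact mul_nonneg hE (Real.rpow_nonneg le_rfl ρ)
    · refine le_trans ?_ (hgood j hj h0)
      have h := sum_card_levelSet_le (Finset.mem_Icc.1 hj).1 J n ω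
      simp only [hV]
      exact_mod_cast h
  have hXb := weighted_sum_le hV0 hanti hE hρ0 hρ hlevel
  rw [← hX, ← hY] at hXb
  have hX2 : w ≤ 2 * X := by linarith
  have h1ρ : 0 < 1 - 2 * ρ := by linarith
  set q := (J : ℝ) ^ (1 - 2 * ρ) / (1 - 2 * ρ) with hq
  have hq0 : 0 ≤ q := by positivity
  refine growth_bound ?_ hwX hYn (by positivity) hε1 hD
  refine hXb.trans ?_
  -- Since `ρ < 1` and `2 X ≥ w`, the sublinear term becomes a small multiple of `X`, to be absorbed
  -- on the left.
  have h2 : (2 * X) ^ ρ ≤ 2 * X * w ^ (ρ - 1) := by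
    have h2X : 0 < 2 * X := by linarith
    have e : (2 * X) ^ ρ = 2 * X * (2 * X) ^ (ρ - 1) := by
      rw [Real.rpow_sub_one h2X.ne', mul_div_cancel₀ _ h2X.ne']
    rw [e]
    exact mul_le_mul_of_nonneg_left
      (Real.rpow_le_rpow_of_nonpos hw0 hX2 (by linarith)) h2X.le
  calc D * Y + E * ((2 * X) ^ ρ * q) ≤ D * Y + E * (2 * X * w ^ (ρ - 1) * q) := by gcongr
    _ = _ := by ring

/-- The cardinality is part of the union bound because the parameter `θ` of the supermartingale
depends on it. -/
theorem measure_bad_le [NeZero d] (hd : 5 ≤ d) {ρ C E : ℝ} (hC1 : 1 ≤ C) (hρ : 0 ≤ ρ)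
    (hC : ∀ (A : Finset (Fin d → ℤ)) (x : Fin d → ℤ), potential A x ≤ C * (A.card : ℝ) ^ ρ)
    (n J : ℕ) :
    (P₀ d).real {ω | ∃ j ∈ Finset.Icc 1 J, 1 ≤ (levelSet j n ω).card ∧
      3 / 2 * greenReal d 0 * (levelSet j n ω).card + E * ((levelSet j n ω).card : ℝ) ^ ρ <
        revisits j (n + 1) ω} ≤ J * ((n + 1) * (2 * Real.exp (-(E / (6 * C))))) := by
  have hsub : {ω : ℕ → Step d | ∃ j ∈ Finset.Icc 1 J, 1 ≤ (levelSet j n ω).card ∧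
      3 / 2 * greenReal d 0 * (levelSet j n ω).card + E * ((levelSet j n ω).card : ℝ) ^ ρ <
        revisits j (n + 1) ω} ⊆
      ⋃ j ∈ Finset.Icc 1 J, ⋃ V ∈ Finset.Icc 1 (n + 1), {ω | (levelSet j n ω).card = V ∧
        3 / 2 * greenReal d 0 * V + E * (V : ℝ) ^ ρ ≤ revisits j (n + 1) ω} := by
    rintro ω ⟨j, hj, h1, h2⟩
    have hcard : (levelSet j n ω).card ≤ n + 1 := by
      rw [card_levelSet (Finset.mem_Icc.1 hj).1]
      exact (Finset.card_filter_le _ _).trans (by simp)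
    exact Set.mem_biUnion hj (Set.mem_biUnion (Finset.mem_Icc.2 ⟨h1, hcard⟩) ⟨rfl, h2.le⟩)
  refine (measureReal_mono hsub (measure_ne_top _ _)).trans
    ((measureReal_biUnion_finset_le _ _).trans ?_)
  calc _ ≤ ∑ _j ∈ Finset.Icc 1 J, ((n : ℝ) + 1) * (2 * Real.exp (-(E / (6 * C)))) := by
        refine Finset.sum_le_sum fun j hj => (measureReal_biUnion_finset_le _ _).trans ?_
        calc _ ≤ ∑ _V ∈ Finset.Icc 1 (n + 1), 2 * Real.exp (-(E / (6 * C))) :=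
              Finset.sum_le_sum fun V hV => measure_revisits_le hd hC1 hρ hC
                (Finset.mem_Icc.1 hj).1 (Finset.mem_Icc.1 hV).1 n
          _ = _ := by simp
    _ = _ := by simp

end Main

end SimpleRandomWalk

theorem lemma2p1 (d : ℕ) [NeZero d] (hd : 5 ≤ d) (b γ z : ℝ) (hb : 0 < b)
    (h : (γ = 1 ∧ 1 + 2 * ∑' x : Fin d → ℤ, SimpleRandomWalk.green d x ^ 2 < ENNReal.ofReal z) ∨
      (1 < γ ∧ 0 < z))
    (ζ : ℝ) (hζ : ζ < γ - b - 2 / (d : ℝ) * (γ - 2 * b)) :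
    ∃ c : ℝ, 0 < c ∧ ∃ N : ℕ, ∀ n : ℕ, N ≤ n →
      (SimpleRandomWalk.P₀ d).real
          {ω | (n : ℝ) ^ γ * z ≤ SimpleRandomWalk.lowSum b n ω} ≤
        Real.exp (-c * (n : ℝ) ^ ζ) := by
  open SimpleRandomWalk Filter Topology in
  have hd5 : (5 : ℝ) ≤ d := by exact_mod_cast hd
  have hd4 : 4 / (d : ℝ) ≤ 1 := by rw [div_le_one (by linarith)]; linarith
  set g := greenReal d 0 with hg
  have hg1 : 1 ≤ g := one_le_greenReal_zero hd
  have hγ : 1 ≤ γ := h.elim (fun h => h.1.ge) fun h => h.1.le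
  have hcase : (γ = 1 ∧ 2 * (3 / 2 * g) - 1 < z) ∨ (1 < γ ∧ 0 < z) := by
    refine h.imp_left fun h => ⟨h.1, ?_⟩
    have := greenReal_sq_lt hd h.2
    nlinarith [sq_nonneg (g - 3 / 4)]
  have hz : 0 < z := hcase.elim (fun h => by linarith [h.2]) fun h => h.2
  -- Local times never exceed `n + 1 ≤ n ^ (1 + 1/d)` for large `n`, so capping `b` loses no site.
  -- It keeps the exponent positive, and can only raise it since `d > 4`.
  set β := min b (1 + 1 / (d : ℝ)) with hβ
  have hβ0 : 0 < β := lt_min hb (by positivity)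
  have hβ1 : β ≤ 1 + 1 / (d : ℝ) := min_le_right _ _
  have hβ2 : β ≤ 2 := hβ1.trans (by
    have : 1 / (d : ℝ) ≤ 1 := by rw [div_le_one (by linarith)]; linarith
    linarith)
  have hζβ : ζ < γ - β - 2 / (d : ℝ) * (γ - 2 * β) := by
    refine hζ.trans_le ?_
    have h1 : β * (1 - 4 / (d : ℝ)) ≤ b * (1 - 4 / (d : ℝ)) :=
      mul_le_mul_of_nonneg_right (min_le_left _ _) (by linarith)
    have e : 4 / (d : ℝ) = 2 * (2 / (d : ℝ)) := by ring
    rw [e] at h1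
    linarith
  obtain ⟨ρ, σ, hρd, hρ2, hσ, hζσ, hσγ⟩ := exists_exponent hd hγ hβ1 hζβ
  have hρ0 : 0 < ρ := lt_trans (by positivity) hρd
  obtain ⟨C, hC1, hC⟩ := exists_sum_greenReal_le hd hρd (by linarith)
  have hκ : 0 < 1 / (6 * C) := by positivity
  have h1ρ : 0 < 1 - 2 * ρ := by linarith
  set ε : ℕ → ℝ := fun n => 2 * (n : ℝ) ^ σ * ((n : ℝ) ^ γ * z) ^ (ρ - 1) *
    (((n : ℝ) ^ β) ^ (1 - 2 * ρ) / (1 - 2 * ρ)) with hε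
  have hεlim : Tendsto ε atTop (𝓝 0) := by
    -- This is the total power of `n` in `ε`; its negativity is exactly `σ < γ - β - ρ (γ - 2β)`.
    have hr : 0 < -(σ + γ * (ρ - 1) + β * (1 - 2 * ρ)) := by linarith
    have hlim := ((tendsto_rpow_neg_atTop hr).comp tendsto_natCast_atTop_atTop).const_mul
      (2 * z ^ (ρ - 1) / (1 - 2 * ρ))
    rw [mul_zero] at hlim
    refine hlim.congr' ?_
    filter_upwards [eventually_ge_atTop 1] with n hn
    have hn0 : (0 : ℝ) < n := by exact_mod_cast hn
    simp only [hε, Function.comp_apply, neg_neg]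
    rw [Real.mul_rpow (by positivity) hz.le, ← Real.rpow_mul hn0.le, ← Real.rpow_mul hn0.le,
      Real.rpow_add hn0, Real.rpow_add hn0]
    ring
  have hbig : ∀ᶠ n : ℕ in atTop, (n : ℝ) + 1 ≤ (n : ℝ) ^ (1 + 1 / (d : ℝ)) := by
    have h1 := (tendsto_rpow_atTop (show 0 < 1 / (d : ℝ) by positivity)).comp
      tendsto_natCast_atTop_atTop |>.eventually (eventually_ge_atTop (2 : ℝ))
    filter_upwards [h1, eventually_ge_atTop 1] with n hn hn1
    have hn1' : (1 : ℝ) ≤ n := by exact_mod_cast hn1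
    rw [Real.rpow_add (by linarith), Real.rpow_one]
    simp only [Function.comp_apply] at hn
    nlinarith
  obtain ⟨N, hN⟩ := eventually_atTop.1
    ((eventually_union_bound_le hβ2 hκ hσ hζσ).and
      ((eventually_growth hcase hεlim).and (hbig.and (eventually_ge_atTop 1))))
  refine ⟨1, one_pos, N, fun n hn => ?_⟩
  obtain ⟨hunion, ⟨hε1, hgrow⟩, hnbig, hn1⟩ := hN n hn
  have hn0 : (0 : ℝ) < n := by exact_mod_cast hn1
  set J := ⌊(n : ℝ) ^ β⌋₊ with hJ
  have hJle : (J : ℝ) ≤ (n : ℝ) ^ β := Nat.floor_le (by positivity)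
  have hJb : ∀ l : ℕ, l ≤ n + 1 → (l : ℝ) ≤ (n : ℝ) ^ b → l ≤ J := by
    intro l hl hlb
    refine Nat.le_floor ?_
    rcases min_choice b (1 + 1 / (d : ℝ)) with hm | hm
    · rwa [hβ, hm]
    · rw [hβ, hm]
      refine le_trans ?_ hnbig
      exact_mod_cast hl
  have hsub : {ω : ℕ → Step d | (n : ℝ) ^ γ * z ≤ lowSum b n ω} ⊆
      {ω | ∃ j ∈ Finset.Icc 1 J, 1 ≤ (levelSet j n ω).card ∧
        3 / 2 * g * (levelSet j n ω).card + (n : ℝ) ^ σ * ((levelSet j n ω).card : ℝ) ^ ρ <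
          revisits j (n + 1) ω} := by
    intro ω hω
    by_contra hbad
    simp only [Set.mem_ofPred_eq, not_exists, not_and, not_lt] at hbad
    set w := (n : ℝ) ^ γ * z with hw
    have hw0 : 0 < w := by positivity
    set δ := 2 * (n : ℝ) ^ σ * w ^ (ρ - 1) * ((J : ℝ) ^ (1 - 2 * ρ) / (1 - 2 * ρ)) with hδ
    have hδε : δ ≤ ε n := by
      rw [hδ]
      simp only [hε]
      gcongr
    have hlow := growth_bound_of_revisits_le hJb (by positivity) (by linarith) hρ0.le hρ2 hbad hw0 hω
      (hδε.trans hε1)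
    rw [← hδ] at hlow
    have h1 : (1 - ε n) * w ≤ (1 - δ) * w := by gcongr
    have h2 : (2 * (3 / 2 * g) - 1 + δ) * ((n : ℝ) + 1) ≤
        (2 * (3 / 2 * g) - 1 + ε n) * ((n : ℝ) + 1) := by gcongr
    linarith
  refine (measureReal_mono hsub).trans ((measure_bad_le hd hC1 hρ0.le hC n J).trans ?_)
  refine le_trans ?_ hunion
  have e : (n : ℝ) ^ σ / (6 * C) = 1 / (6 * C) * (n : ℝ) ^ σ := by ring
  rw [e]
  gcongr
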